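/- Let $G$ be a connected complex reductive group, i.e. a connected Zariski closed subgroup of some $GL_n(\mathbb{C})$ with trivial unipotent radical, and let $\mathfrak g$ be its Lie algebra. Let $\mathbb{A}=\mathbb{C}$ be the affine line and let $\mathbb{C}\ltimes\mathbb{A}$ be the action groupoid of the action $(\lambda,z)\mapsto e^{\lambda}z$, in which $(\lambda,z)$ is an arrow from $z$ to $e^{\lambda}z$. A representation of $\mathbb{C}\ltimes\mathbb{A}$ on a holomorphic principal $G$-bundle $P\to\mathbb{A}$ is a holomorphic groupoid homomorphism $\Phi$ from $\mathbb{C}\ltimes\mathbb{A}$ to the gauge groupoid of $P$: a family of $G$-equivariant maps $\Phi(\lambda,z):P_z\to P_{e^{\lambda}z}$, holomorphic in $(\lambda,z)$, with $\Phi(0,z)=\mathrm{id}$ and $\Phi(\lambda+\mu,z)=\Phi(\lambda,e^{\mu}z)\circ\Phi(\mu,z)$. An isomorphism between representations $(P,\Phi)$ and $(Q,\Psi)$ is a holomorphic isomorphism of principal $G$-bundles $T:P\to Q$ over the identity of $\mathbb{A}$ with $T_{e^{\lambda}z}\circ\Phi(\lambda,z)=\Psi(\lambda,z)\circ T_z$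 for all $(\lambda,z)$. The residue $\mathrm{Res}(\Phi)$ is the unique element of the Lie algebra $\mathfrak{aut}_G(P_0)$ of $\mathrm{Aut}_G(P_0)$ such that $\Phi(\lambda,0)=\exp(\lambda\,\mathrm{Res}(\Phi))$ for all $\lambda\in\mathbb{C}$. The linear approximation $L(\Phi)$ is the representation on the trivial bundle $P_0\times\mathbb{A}$ given by $L(\Phi)(\lambda,z)=\exp(\lambda\,\mathrm{Res}(\Phi))$, i.e. $(p,z)\mapsto(\exp(\lambda\,\mathrm{Res}(\Phi))(p),e^{\lambda}z)$. The representation $\Phi$ is linearizable if there is an isomorphism of representations $L(\Phi)\to\Phi$. Proposition. Let $\Phi$ be a representation of $\mathbb{C}\ltimes\mathbb{A}$ on a holomorphic principal $G$-bundle $P$. (1) $\Phi$ is linearizable if and only if its monodromy $\Phi(2\pi i,1)\in\mathrm{Aut}_G(P_1)$ is conjugate to $\exp(2\pi i\,\mathrm{Res}(\Phi))\in\mathrm{Aut}_G(P_0)$, i.e. if and only if there is a $G$-equivariant map $C:P_0\to P_1$ with $\Phi(2\pi i,1)\circ C=C\circ\exp(2\pi i\,\mathrm{Res}(\Phi))$.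 (2) If the monodromy $\Phi(2\pi i,1)$ is semisimple (that is, the element of $G$ that corresponds to it under the choice of a point of $P_1$ is a diagonalizable matrix), then $\Phi$ is linearizable. -/

import Mathlib

open scoped RightActions MatrixGroups

universe u

/-! ### Connected complex reductive groups, realised as linear algebraic groups -/

/-- `G ≤ GL_n(ℂ)` is Zariski closed: it is the zero locus in `GL_n(ℂ)` of a set of polynomials in
the matrix entries. -/
def IsZariskiClosedSubgroup {n : ℕ} (G : Subgroup (GL (Fin n) ℂ)) : Prop :=
  ∃ S : Set (MvPolynomial (Fin n × Fin n) ℂ), ∀ g : GL (Fin n) ℂ,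
    g ∈ G ↔ ∀ f ∈ S,
      MvPolynomial.eval (fun ab => (g : Matrix (Fin n) (Fin n) ℂ) ab.1 ab.2) f = 0

/-- `g` is unipotent: `g - 1` is nilpotent. -/
def IsUnipotentElt {n : ℕ} (g : GL (Fin n) ℂ) : Prop :=
  IsNilpotent ((g : Matrix (Fin n) (Fin n) ℂ) - 1)

/-- `g` is semisimple: it can be diagonalized. -/
def IsSemisimpleElt {n : ℕ} (g : GL (Fin n) ℂ) : Prop :=
  ∃ Q : GL (Fin n) ℂ, ((Q⁻¹ * g * Q : GL (Fin n) ℂ) : Matrix (Fin n) (Fin n) ℂ).IsDiag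

/-- `G` is a connected complex reductive group: a connected linear algebraic group over `ℂ`
whose unipotent radical is trivial, i.e. the only connected Zariski closed normal subgroup of `G`
which consists of unipotent elements is the trivial one. -/
structure IsConnectedReductive {n : ℕ} (G : Subgroup (GL (Fin n) ℂ)) : Prop where
  zariskiClosed : IsZariskiClosedSubgroup G
  connected : IsConnected (G : Set (GL (Fin n) ℂ))
  reductive : ∀ N : Subgroup (GL (Fin n) ℂ), N ≤ G →
    (∀ g ∈ G, ∀ x ∈ N, g * x * g⁻¹ ∈ N) → IsZariskiClosedSubgroup N →
    IsConnected (N : Set (GL (Fin n) ℂ)) → (∀ x ∈ N, IsUnipotentElt x) → N = ⊥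

/-- The exponential of a matrix, as an element of `GL_n(ℂ)`. -/
noncomputable def expGL {n : ℕ} (X : Matrix (Fin n) (Fin n) ℂ) : GL (Fin n) ℂ :=
  (Matrix.isUnit_exp X).unit

theorem coe_expGL {n : ℕ} (X : Matrix (Fin n) (Fin n) ℂ) :
    (expGL X : Matrix (Fin n) (Fin n) ℂ) = NormedSpace.exp X := rfl

/-- The Lie algebra `𝔤` of `G`: the matrices whose complex one-parameter subgroup lies in `G`. -/
def lieAlg {n : ℕ} (G : Subgroup (GL (Fin n) ℂ)) : Set (Matrix (Fin n) (Fin n) ℂ) :=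
  {X | ∀ t : ℂ, expGL (t • X) ∈ G}

/-- A map into `G ≤ GL_n(ℂ)` is holomorphic on `s` if its matrix entries are. -/
def IsHolomorphicOn {n : ℕ} {G : Subgroup (GL (Fin n) ℂ)} {E : Type*} [NormedAddCommGroup E]
    [NormedSpace ℂ E] (g : E → G) (s : Set E) : Prop :=
  ∀ a b : Fin n, DifferentiableOn ℂ
    (fun x => ((g x : GL (Fin n) ℂ) : Matrix (Fin n) (Fin n) ℂ) a b) s

/-- A holomorphic one-parameter group in a Banach algebra is the exponential of its derivative. -/
theorem eq_exp_of_hasDerivAt {R : Type*} [NormedRing R] [NormedAlgebra ℂ R] [CompleteSpace R]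
    (f : ℂ → R) (A : R) (hf0 : HasDerivAt f A 0) (h0 : f 0 = 1)
    (hadd : ∀ l m, f (l + m) = f l * f m) (l : ℂ) : f l = NormedSpace.exp (l • A) := by
  have hf : ∀ l, HasDerivAt f (f l * A) l := by
    intro l
    have h1 : HasDerivAt (fun m => f (m - l)) A l :=
      HasDerivAt.comp_sub_const (f := f) (f' := A) l l (by simpa using hf0)
    have h2 := h1.const_mul (f l)
    refine h2.congr_of_eventuallyEq (Filter.Eventually.of_forall fun m => ?_)
    change f m = f l * f (m - l)
    rw [← hadd]; congr 1; ring
  have hg : ∀ l, HasDerivAt (fun l => f l * NormedSpace.exp (l • (-A))) 0 l := by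
    intro l
    have h1 := (hf l).mul (hasDerivAt_exp_smul_const' (𝕂 := ℂ) (-A) l)
    have h2 : f l * A * NormedSpace.exp (l • -A) + f l * (-A * NormedSpace.exp (l • -A)) = 0 := by
      rw [mul_assoc, ← mul_add, ← add_mul]
      simp
    rwa [h2] at h1
  have hc : f l * NormedSpace.exp (l • (-A)) = f 0 * NormedSpace.exp ((0 : ℂ) • (-A)) :=
    is_const_of_deriv_eq_zero (fun l => (hg l).differentiableAt) (fun l => (hg l).deriv) l 0
  rw [zero_smul, NormedSpace.exp_zero, h0, mul_one] at hc
  let _ : NormedAlgebra ℚ R := NormedAlgebra.restrictScalars ℚ ℂ R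
  have hu : NormedSpace.exp (l • (-A)) * NormedSpace.exp (l • A) = 1 := by
    rw [← NormedSpace.exp_add_of_commute, ← smul_add, neg_add_cancel, smul_zero,
      NormedSpace.exp_zero]
    rw [smul_neg]
    exact (Commute.refl _).neg_left
  calc f l = f l * (NormedSpace.exp (l • (-A)) * NormedSpace.exp (l • A)) := by rw [hu, mul_one]
    _ = _ := by rw [← mul_assoc, hc, one_mul]

open scoped Matrix.Norms.Operator in
/-- A holomorphic one-parameter group of matrices is the exponential of its derivative at `0`. -/
theorem eq_exp_of_oneParameter {n : ℕ} (f : ℂ → Matrix (Fin n) (Fin n) ℂ)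
    (hd : ∀ a b, DifferentiableAt ℂ (fun l => f l a b) 0) (h0 : f 0 = 1)
    (hadd : ∀ l m, f (l + m) = f l * f m) (l : ℂ) :
    f l = NormedSpace.exp (l • Matrix.of fun a b => deriv (fun l => f l a b) 0) := by
  refine eq_exp_of_hasDerivAt f _ ?_ h0 hadd l
  exact hasDerivAt_pi.2 fun a => hasDerivAt_pi.2 fun b => (hd a b).hasDerivAt

/-! ### Holomorphic principal bundles over the affine line `𝔸 = ℂ` -/

/-- A holomorphic principal `G`-bundle `P → ℂ`: a set with a right action of `G` whose orbits are
the fibres of `proj` and which is free, together with an atlas of local trivializations, given by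
local sections `sec i` over open sets `dom i` that cover `ℂ` and differ by holomorphic maps
`dom i ∩ dom j → G`. The topology and the complex structure of the total space are the ones that
the bijections `dom i × G → proj ⁻¹' (dom i)`, `(z, g) ↦ sec i z <• g` define. (The values
of `sec i` outside `dom i` play no role.) -/
structure HolomorphicPrincipalBundle {n : ℕ} (G : Subgroup (GL (Fin n) ℂ)) where
  Total : Type u
  proj : Total → ℂ
  [action : MulAction Gᵐᵒᵖ Total]
  proj_smul : ∀ (p : Total) (g : G), proj (p <• g) = proj p
  existsUnique_smul : ∀ p q : Total, proj p = proj q → ∃! g : G, p <• g = q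
  Idx : Type u
  dom : Idx → Set ℂ
  isOpen_dom : ∀ i, IsOpen (dom i)
  cover : ∀ z : ℂ, ∃ i, z ∈ dom i
  sec : Idx → ℂ → Total
  proj_sec : ∀ i, ∀ z ∈ dom i, proj (sec i z) = z
  transition : ∀ i j, ∃ g : ℂ → G, IsHolomorphicOn g (dom i ∩ dom j) ∧
    ∀ z ∈ dom i ∩ dom j, sec j z = sec i z <• g z

attribute [instance] HolomorphicPrincipalBundle.action

namespace HolomorphicPrincipalBundle

variable {n : ℕ} {G : Subgroup (GL (Fin n) ℂ)}

/-- The fibre `P_z`. -/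
def Fiber (P : HolomorphicPrincipalBundle.{u} G) (z : ℂ) : Type u :=
  {p : P.Total // P.proj p = z}

instance (P : HolomorphicPrincipalBundle.{u} G) (z : ℂ) : MulAction Gᵐᵒᵖ (P.Fiber z) where
  smul g p := ⟨g • p.1, (P.proj_smul p.1 g.unop).trans p.2⟩
  one_smul p := Subtype.ext (one_smul Gᵐᵒᵖ p.1)
  mul_smul g h p := Subtype.ext (mul_smul g h p.1)

theorem Fiber.coe_smul {P : HolomorphicPrincipalBundle.{u} G} {z : ℂ} (g : Gᵐᵒᵖ)
    (p : P.Fiber z) : (g • p).1 = g • p.1 := rfl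

/-- The point of `P_z` given by the local section `sec i`. -/
def secFiber (P : HolomorphicPrincipalBundle.{u} G) (i : P.Idx) (z : ℂ) (hz : z ∈ P.dom i) :
    P.Fiber z :=
  ⟨P.sec i z, P.proj_sec i z hz⟩

/-- The identity of `P_x = P_y`, for `x = y`. -/
def castFiber (P : HolomorphicPrincipalBundle.{u} G) {x y : ℂ} (h : x = y) :
    P.Fiber x →[Gᵐᵒᵖ] P.Fiber y where
  toFun p := ⟨p.1, p.2.trans h⟩
  map_smul' _ _ := rfl

/-- The element `g` of `G` with `p <• g = q`, for `p` and `q` in the same fibre. -/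
noncomputable def diff {P : HolomorphicPrincipalBundle.{u} G} {z : ℂ} (p q : P.Fiber z) : G :=
  (P.existsUnique_smul p.1 q.1 (p.2.trans q.2.symm)).choose

theorem smul_diff {P : HolomorphicPrincipalBundle.{u} G} {z : ℂ} (p q : P.Fiber z) :
    p <• diff p q = q :=
  Subtype.ext (P.existsUnique_smul p.1 q.1 (p.2.trans q.2.symm)).choose_spec.1

theorem eq_diff {P : HolomorphicPrincipalBundle.{u} G} {z : ℂ} {p q : P.Fiber z} {g : G}
    (h : p <• g = q) : g = diff p q :=
  (P.existsUnique_smul p.1 q.1 (p.2.trans q.2.symm)).choose_spec.2 g (congrArg Subtype.val h)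

/-- The trivial bundle `P_0 × 𝔸`, with its tautological global trivializations. -/
def linearize (P : HolomorphicPrincipalBundle.{u} G) : HolomorphicPrincipalBundle.{u} G where
  Total := P.Fiber 0 × ℂ
  proj p := p.2
  action :=
    { smul := fun g p => (g • p.1, p.2)
      one_smul := fun p => Prod.ext (one_smul Gᵐᵒᵖ p.1) rfl
      mul_smul := fun g h p => Prod.ext (mul_smul g h p.1) rfl }
  proj_smul _ _ := rfl
  existsUnique_smul p q h :=
    ⟨diff p.1 q.1, Prod.ext (smul_diff p.1 q.1) h, fun _ hg => eq_diff (congrArg Prod.fst hg)⟩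
  Idx := P.Fiber 0
  dom _ := Set.univ
  isOpen_dom _ := isOpen_univ
  cover _ := by
    obtain ⟨i, hi⟩ := P.cover 0
    exact ⟨P.secFiber i 0 hi, Set.mem_univ _⟩
  sec p z := (p, z)
  proj_sec _ _ _ := rfl
  transition p q :=
    ⟨fun _ => diff p q, fun _ _ => differentiableOn_const _,
      fun _ _ => Prod.ext (smul_diff p q).symm rfl⟩

/-- The Lie algebra `𝔞𝔲𝔱_G(P_z)` of the group of `G`-equivariant automorphisms of `P_z`:
the `G`-equivariant maps from `P_z` to the adjoint representation `𝔤`. -/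
structure InfAut (P : HolomorphicPrincipalBundle.{u} G) (z : ℂ) where
  toFun : P.Fiber z → Matrix (Fin n) (Fin n) ℂ
  mem_lieAlg : ∀ p, toFun p ∈ lieAlg G
  equivariant : ∀ (p : P.Fiber z) (g : G),
    toFun (p <• g) = ((g⁻¹ : GL (Fin n) ℂ) : Matrix (Fin n) (Fin n) ℂ) * toFun p *
      ((g : GL (Fin n) ℂ) : Matrix (Fin n) (Fin n) ℂ)

noncomputable instance (P : HolomorphicPrincipalBundle.{u} G) (z : ℂ) : SMul ℂ (P.InfAut z) where
  smul c A :=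
    { toFun := fun p => c • A.toFun p
      mem_lieAlg := fun p t => by
        rw [smul_smul]
        exact A.mem_lieAlg p (t * c)
      equivariant := fun p g => by
        rw [A.equivariant, Matrix.mul_smul, Matrix.smul_mul] }

/-- The exponential map `𝔞𝔲𝔱_G(P_z) → Aut_G(P_z)`, `exp(A)(p) = p <• exp(A(p))`. -/
noncomputable def InfAut.exp {P : HolomorphicPrincipalBundle.{u} G} {z : ℂ} (A : P.InfAut z) :
    P.Fiber z →[Gᵐᵒᵖ] P.Fiber z where
  toFun p := p <• (⟨expGL (A.toFun p), by simpa using A.mem_lieAlg p 1⟩ : G)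
  map_smul' g p := by
    induction g with
    | _ g =>
    change _ = MulOpposite.op g • _
    rw [smul_smul, smul_smul, ← MulOpposite.op_mul, ← MulOpposite.op_mul]
    congr 2
    apply Subtype.ext
    apply Units.ext
    have h := Matrix.exp_units_conj' (g : GL (Fin n) ℂ) (A.toFun p)
    simp only [Subgroup.coe_mul, Units.val_mul, coe_expGL, A.equivariant]
    rw [h]
    simp [← mul_assoc]

/-- An element of `Aut_G(P_z)` is semisimple if the element of `G` to which each choice of a point
of `P_z` identifies it is semisimple. -/
def IsSemisimpleAut {P : HolomorphicPrincipalBundle.{u} G} {z : ℂ}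
    (T : P.Fiber z →[Gᵐᵒᵖ] P.Fiber z) : Prop :=
  ∀ p : P.Fiber z, IsSemisimpleElt (diff p (T p) : GL (Fin n) ℂ)

/-- `S ∈ Aut_G(P_x)` and `T ∈ Aut_G(P_y)` are conjugate: a `G`-equivariant map `P_y → P_x`
(which is automatically bijective) intertwines them. -/
def AreConjugate {P : HolomorphicPrincipalBundle.{u} G} {x y : ℂ}
    (S : P.Fiber x →[Gᵐᵒᵖ] P.Fiber x) (T : P.Fiber y →[Gᵐᵒᵖ] P.Fiber y) : Prop :=
  ∃ C : P.Fiber y →[Gᵐᵒᵖ] P.Fiber x, ∀ p : P.Fiber y, S (C p) = C (T p)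

end HolomorphicPrincipalBundle

open HolomorphicPrincipalBundle

/-! ### Representations of the action groupoid `ℂ ⋉ 𝔸` -/

/-- A representation of the action groupoid `ℂ ⋉ 𝔸`, whose arrow `(l, z)` goes from `z` to
`e^l z`, on `P`: a holomorphic homomorphism into the gauge groupoid of `P`, whose arrows from `x`
to `y` are the `G`-equivariant maps `P_x → P_y`. Holomorphy is tested in the charts
`dom j × G × dom i` of the gauge groupoid that the local trivializations define. -/
structure GroupoidRep {n : ℕ} {G : Subgroup (GL (Fin n) ℂ)}
    (P : HolomorphicPrincipalBundle.{u} G) where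
  toFun : ∀ l z : ℂ, P.Fiber z →[Gᵐᵒᵖ] P.Fiber (Complex.exp l * z)
  map_zero : ∀ (z : ℂ) (p : P.Fiber z), (toFun 0 z p).1 = p.1
  map_add : ∀ (l m z : ℂ) (p : P.Fiber z),
    (toFun (l + m) z p).1 = (toFun l (Complex.exp m * z) (toFun m z p)).1
  holomorphic : ∀ i j : P.Idx, ∃ g : ℂ × ℂ → G,
    IsHolomorphicOn g {x | x.2 ∈ P.dom i ∧ Complex.exp x.1 * x.2 ∈ P.dom j} ∧
    ∀ (l z : ℂ) (hi : z ∈ P.dom i) (hj : Complex.exp l * z ∈ P.dom j),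
      toFun l z (P.secFiber i z hi) = P.secFiber j (Complex.exp l * z) hj <• g (l, z)

namespace GroupoidRep

variable {n : ℕ} {G : Subgroup (GL (Fin n) ℂ)}

/-- A morphism of representations: a holomorphic map of principal bundles over the identity of `𝔸`
which intertwines the two actions. -/
structure Hom {P Q : HolomorphicPrincipalBundle.{u} G} (Φ : GroupoidRep P) (Ψ : GroupoidRep Q) where
  toFun : ∀ z : ℂ, P.Fiber z →[Gᵐᵒᵖ] Q.Fiber z
  holomorphic : ∀ (i : P.Idx) (j : Q.Idx), ∃ g : ℂ → G, IsHolomorphicOn g (P.dom i ∩ Q.dom j) ∧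
    ∀ (z : ℂ) (hi : z ∈ P.dom i) (hj : z ∈ Q.dom j),
      toFun z (P.secFiber i z hi) = Q.secFiber j z hj <• g z
  comm : ∀ (l z : ℂ) (p : P.Fiber z),
    toFun (Complex.exp l * z) (Φ.toFun l z p) = Ψ.toFun l z (toFun z p)

/-- Two representations are isomorphic: there are mutually inverse morphisms between them. -/
def IsIsomorphic {P Q : HolomorphicPrincipalBundle.{u} G} (Φ : GroupoidRep P)
    (Ψ : GroupoidRep Q) : Prop :=
  ∃ (T : Hom Φ Ψ) (S : Hom Ψ Φ), (∀ z p, S.toFun z (T.toFun z p) = p) ∧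
    ∀ z q, T.toFun z (S.toFun z q) = q

/-- The restriction of `Φ` to the isotropy group `ℂ` of `0`: the homomorphism
`ℂ → Aut_G(P_0)`, `l ↦ Φ(l, 0)`. -/
noncomputable def restrictZero {P : HolomorphicPrincipalBundle.{u} G} (Φ : GroupoidRep P) (l : ℂ) :
    P.Fiber 0 →[Gᵐᵒᵖ] P.Fiber 0 :=
  (P.castFiber (mul_zero _)).comp (Φ.toFun l 0)

theorem restrictZero_zero {P : HolomorphicPrincipalBundle.{u} G} (Φ : GroupoidRep P)
    (p : P.Fiber 0) : Φ.restrictZero 0 p = p :=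
  Subtype.ext (Φ.map_zero 0 p)

theorem toFun_congr {P : HolomorphicPrincipalBundle.{u} G} (Φ : GroupoidRep P) (l : ℂ) {z w : ℂ}
    {p : P.Fiber z} {q : P.Fiber w} (h : p.1 = q.1) : (Φ.toFun l z p).1 = (Φ.toFun l w q).1 := by
  obtain ⟨p, rfl⟩ := p
  obtain ⟨q, rfl⟩ := q
  obtain rfl : p = q := h
  rfl

theorem restrictZero_add {P : HolomorphicPrincipalBundle.{u} G} (Φ : GroupoidRep P) (l m : ℂ)
    (p : P.Fiber 0) : Φ.restrictZero (l + m) p = Φ.restrictZero l (Φ.restrictZero m p) :=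
  Subtype.ext ((Φ.map_add l m 0 p).trans (Φ.toFun_congr l rfl))

/-- The one-parameter group `ℂ → G` that describes the restriction of `Φ` to `0` with respect to
the point `p` of `P_0`. -/
noncomputable def oneParam {P : HolomorphicPrincipalBundle.{u} G} (Φ : GroupoidRep P)
    (p : P.Fiber 0) (l : ℂ) : Matrix (Fin n) (Fin n) ℂ :=
  ((diff p (Φ.restrictZero l p) : G) : GL (Fin n) ℂ)

theorem restrictZero_smul {P : HolomorphicPrincipalBundle.{u} G} (Φ : GroupoidRep P)
    (p : P.Fiber 0) (g : G) (l : ℂ) : Φ.restrictZero l (p <• g) = Φ.restrictZero l p <• g :=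
  map_smul (Φ.restrictZero l) (MulOpposite.op g) p

theorem oneParam_smul {P : HolomorphicPrincipalBundle.{u} G} (Φ : GroupoidRep P)
    (p : P.Fiber 0) (g : G) (l : ℂ) :
    Φ.oneParam (p <• g) l = ((g⁻¹ : GL (Fin n) ℂ) : Matrix (Fin n) (Fin n) ℂ) * Φ.oneParam p l *
      ((g : GL (Fin n) ℂ) : Matrix (Fin n) (Fin n) ℂ) := by
  have h : g⁻¹ * diff p (Φ.restrictZero l p) * g
      = diff (p <• g) (Φ.restrictZero l (p <• g)) := by
    apply eq_diff
    rw [restrictZero_smul, smul_smul, ← MulOpposite.op_mul, ← mul_assoc, mul_inv_cancel_left,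
      MulOpposite.op_mul, ← smul_smul, smul_diff]
  rw [oneParam, ← h]
  simp [oneParam]

theorem oneParam_zero {P : HolomorphicPrincipalBundle.{u} G} (Φ : GroupoidRep P)
    (p : P.Fiber 0) : Φ.oneParam p 0 = 1 := by
  have h : (1 : G) = diff p (Φ.restrictZero 0 p) := by
    apply eq_diff
    rw [restrictZero_zero, MulOpposite.op_one, one_smul]
  rw [oneParam, ← h]
  simp

theorem oneParam_add {P : HolomorphicPrincipalBundle.{u} G} (Φ : GroupoidRep P)
    (p : P.Fiber 0) (l m : ℂ) : Φ.oneParam p (l + m) = Φ.oneParam p l * Φ.oneParam p m := by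
  have h : diff p (Φ.restrictZero l p) * diff p (Φ.restrictZero m p)
      = diff p (Φ.restrictZero (l + m) p) := by
    apply eq_diff
    rw [MulOpposite.op_mul, ← smul_smul, smul_diff, ← restrictZero_smul, smul_diff,
      restrictZero_add]
  rw [oneParam, ← h]
  simp [oneParam]

theorem differentiable_oneParam {P : HolomorphicPrincipalBundle.{u} G} (Φ : GroupoidRep P)
    (p : P.Fiber 0) (a b : Fin n) : Differentiable ℂ fun l => Φ.oneParam p l a b := by
  obtain ⟨i, hi⟩ := P.cover 0
  obtain ⟨g, hg, hgs⟩ := Φ.holomorphic i i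
  have hs : ∀ a b, Differentiable ℂ fun l => Φ.oneParam (P.secFiber i 0 hi) l a b := by
    intro a b
    have h1 : ∀ l, Φ.oneParam (P.secFiber i 0 hi) l
        = ((g (l, 0) : GL (Fin n) ℂ) : Matrix (Fin n) (Fin n) ℂ) := by
      intro l
      have h2 : g (l, 0) = diff (P.secFiber i 0 hi) (Φ.restrictZero l (P.secFiber i 0 hi)) := by
        apply eq_diff
        have hj : Complex.exp l * 0 ∈ P.dom i := by rwa [mul_zero]
        have h3 := congrArg (P.castFiber (mul_zero (Complex.exp l))) (hgs l 0 hi hj)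
        have h4 : P.castFiber (mul_zero (Complex.exp l)) (P.secFiber i _ hj)
            = P.secFiber i 0 hi := Subtype.ext (congrArg (P.sec i) (mul_zero _))
        rw [map_smul, h4] at h3
        exact h3.symm
      rw [oneParam, ← h2]
    simp only [h1]
    intro l
    have h5 := (hg a b).comp (s := Set.univ) (f := fun l : ℂ => (l, (0 : ℂ)))
      (differentiable_id.prodMk (differentiable_const 0)).differentiableOn
      (fun l _ => ⟨hi, by simpa using hi⟩)
    exact (differentiableOn_univ.1 h5) l
  rw [← smul_diff (P.secFiber i 0 hi) p]
  simp only [oneParam_smul, Matrix.mul_apply]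
  fun_prop

/-- The residue at `p`: the derivative at `0` of the one-parameter group. -/
noncomputable def residueFun {P : HolomorphicPrincipalBundle.{u} G} (Φ : GroupoidRep P)
    (p : P.Fiber 0) : Matrix (Fin n) (Fin n) ℂ :=
  Matrix.of fun a b => deriv (fun l => Φ.oneParam p l a b) 0

theorem expGL_residueFun {P : HolomorphicPrincipalBundle.{u} G} (Φ : GroupoidRep P)
    (p : P.Fiber 0) (l : ℂ) :
    expGL (l • Φ.residueFun p) = (diff p (Φ.restrictZero l p) : G) :=
  Units.ext (eq_exp_of_oneParameter (Φ.oneParam p)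
    (fun a b => Φ.differentiable_oneParam p a b 0) (Φ.oneParam_zero p) (Φ.oneParam_add p) l).symm

/-- The residue `Res(Φ) ∈ 𝔞𝔲𝔱_G(P_0)`: the derivative at `l = 0` of `l ↦ Φ(l, 0)`. -/
noncomputable def residue {P : HolomorphicPrincipalBundle.{u} G} (Φ : GroupoidRep P) :
    P.InfAut 0 where
  toFun := Φ.residueFun
  mem_lieAlg p l := by
    rw [expGL_residueFun]
    exact SetLike.coe_mem _
  equivariant p g := by
    ext a b
    have hd : ∀ a b, HasDerivAt (fun l => Φ.oneParam p l a b) (Φ.residueFun p a b) 0 :=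
      fun a b => (Φ.differentiable_oneParam p a b 0).hasDerivAt
    refine HasDerivAt.deriv ?_
    simp only [oneParam_smul, Matrix.mul_apply]
    refine HasDerivAt.fun_sum fun c _ => HasDerivAt.mul_const ?_ _
    exact HasDerivAt.fun_sum fun d _ => HasDerivAt.const_mul _ (hd d c)

/-- The restriction of `Φ` to `0` is the one-parameter group of the residue:
`Φ(l, 0) = exp(l Res(Φ))`. -/
theorem restrictZero_eq_exp {P : HolomorphicPrincipalBundle.{u} G} (Φ : GroupoidRep P) (l : ℂ) :
    Φ.restrictZero l = (l • Φ.residue).exp := by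
  ext p
  have h : (⟨expGL (l • Φ.residueFun p), Φ.residue.mem_lieAlg p l⟩ : G)
      = diff p (Φ.restrictZero l p) := Subtype.ext (Φ.expGL_residueFun p l)
  change _ = p <• (⟨expGL (l • Φ.residueFun p), Φ.residue.mem_lieAlg p l⟩ : G)
  rw [h, smul_diff]

/-- The linear approximation `L(Φ)`: the trivial representation `(l, z) ↦ Φ(l, 0) = exp(l Res(Φ))`
on the trivial bundle `P_0 × 𝔸`. -/
noncomputable def linearApprox {P : HolomorphicPrincipalBundle.{u} G} (Φ : GroupoidRep P) :
    GroupoidRep P.linearize where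
  toFun l z :=
    { toFun := fun p => ⟨((l • Φ.residue).exp p.1.1, Complex.exp l * z), rfl⟩
      map_smul' := fun g p =>
        Subtype.ext (Prod.ext (map_smul (l • Φ.residue).exp g p.1.1) rfl) }
  map_zero z p := by
    refine Prod.ext ?_ ?_
    · change (((0 : ℂ) • Φ.residue).exp p.1.1) = _
      rw [← restrictZero_eq_exp, restrictZero_zero]
    · change Complex.exp 0 * z = p.1.2
      rw [Complex.exp_zero, one_mul]
      exact p.2.symm
  map_add l m z p := by
    refine Prod.ext ?_ ?_
    · change ((l + m) • Φ.residue).exp p.1.1 = (l • Φ.residue).exp ((m • Φ.residue).exp p.1.1)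
      simp only [← restrictZero_eq_exp, restrictZero_add]
    · change Complex.exp (l + m) * z = Complex.exp l * (Complex.exp m * z)
      rw [Complex.exp_add, mul_assoc]
  holomorphic := by
    intro (p : P.Fiber 0) (q : P.Fiber 0)
    refine ⟨fun x => diff q p * diff p (Φ.restrictZero x.1 p), fun a b => ?_,
      fun l z _ _ => ?_⟩
    · have h : ∀ c d, Differentiable ℂ fun x : ℂ × ℂ => Φ.oneParam p x.1 c d :=
        fun c d => (Φ.differentiable_oneParam p c d).comp differentiable_fst
      simp only [Subgroup.coe_mul, Units.val_mul, Matrix.mul_apply]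
      exact (Differentiable.fun_sum fun c _ => (h c b).const_mul _).differentiableOn
    · refine Subtype.ext (Prod.ext ?_ rfl)
      change (l • Φ.residue).exp p = q <• (diff q p * diff p (Φ.restrictZero l p))
      rw [← restrictZero_eq_exp, MulOpposite.op_mul, ← smul_smul, smul_diff, smul_diff]

/-- `Φ` is linearizable: it is isomorphic to its linear approximation. -/
def IsLinearizable {P : HolomorphicPrincipalBundle.{u} G} (Φ : GroupoidRep P) : Prop :=
  IsIsomorphic Φ.linearApprox Φ

/-- The monodromy `M(z) = Φ(2πi, z) ∈ Aut_G(P_z)`. -/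
noncomputable def monodromy {P : HolomorphicPrincipalBundle.{u} G} (Φ : GroupoidRep P) (z : ℂ) :
    P.Fiber z →[Gᵐᵒᵖ] P.Fiber z :=
  (P.castFiber (by rw [Complex.exp_two_pi_mul_I, one_mul])).comp
    (Φ.toFun (2 * Real.pi * Complex.I) z)

end GroupoidRep

/-!
In a trivialization over a disc around `0`, the representation is a holomorphic cocycle `A(l, z)`
with values in `G`, defined whenever `z` and `e^l z` lie in the disc, and `A(l, 0) = exp(l R)` with
`R` the residue. The proof is a comparison of centralizers in the Lie algebra `𝔤`.

* *A criterion.* Suppose that `R` extends to a holomorphic section `X` of the adjoint bundle over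
  the disc which is invariant under the representation. Then `A(l, z) exp(-l X(z))` is again a
  cocycle, and it is trivial at `z = 0`. Such a cocycle is trivialized by the limit of its values at
  `(-m, z)` for `m → ∞`, an infinite product that converges because the points `e^{-m} z` approach
  `0` geometrically (`LocalCocycle.exists_trivialization`). In the new trivialization `X` is
  invariant under dilations, hence constant, and the representation is `exp(l R)`
  (`LocalCocycle.exists_linearization_of_invariant_section`). The action of `ℂ` carries the
  linearization from the disc to all of `𝔸` (`GroupoidRep.nonempty_hom_of_local_linearization`).

* *Existence of the section.* The invariant sections over the punctured disc correspond to the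
  centralizer in `𝔤` of the monodromy `M`. They have at most a pole at `0`, and the leading
  coefficient of one of order `k` lies in `E_k = {c | Ad(exp(l R)) c = e^{k l} c for all l}`. The
  spaces `E_k` are independent subspaces of the centralizer of `exp(2πi R)`. If this centralizer is
  not larger than that of `M`, the leading coefficients have to exhaust all of the `E_k`
  (`exists_leading_eq_of_finrank_le`). In particular `R ∈ E_0` is the value at `0` of an invariant
  section (`LocalCocycle.exists_invariant_section`).

* *The inequality between the centralizers.* It is clear if `M` and `exp(2πi R)` are conjugate
  in `G`. In general, the characteristic polynomial of the adjoint action of the monodromy at `z`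
  on `𝔤` does not depend on `z ≠ 0`, nor, by continuity, on `z`. The multiplicity of its root `1`
  bounds the dimension of the centralizer of `exp(2πi R)`, and equals that of `M` if `M` is
  semisimple (`LocalCocycle.finrank_lieCentralizer_le_of_isSemisimpleElt`).

Conversely, the fibre over `1` of an isomorphism from the linear approximation conjugates the
monodromies. That `𝔤`, defined by one-parameter groups, is a vector space is the Lie product
formula.
-/

open Filter Topology
open scoped Matrix.Norms.Operator

/-! ### The Lie algebra of a closed subgroup of `GL_n(ℂ)` -/

theorem norm_pow_sub_pow_le_of_norm_le {R : Type*} [NormedRing R] (h1 : ‖(1 : R)‖ ≤ 1) {a b : R}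
    {c : ℝ} (hc : 1 ≤ c) (ha : ‖a‖ ≤ c) (hb : ‖b‖ ≤ c) (k : ℕ) :
    ‖a ^ k - b ^ k‖ ≤ k * ‖a - b‖ * c ^ k := by
  have hpow : ∀ k : ℕ, ‖a ^ k‖ ≤ c ^ k := by
    intro k
    induction k with
    | zero => simpa using h1
    | succ k ih =>
      rw [pow_succ, pow_succ]
      exact (norm_mul_le _ _).trans (by gcongr)
  induction k with
  | zero => simp
  | succ k ih =>
    have h2 : a ^ (k + 1) - b ^ (k + 1) = a ^ k * (a - b) + (a ^ k - b ^ k) * b := by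
      rw [pow_succ, pow_succ]; noncomm_ring
    have h3 : c ^ k ≤ c ^ (k + 1) := pow_le_pow_right₀ hc (Nat.le_succ k)
    calc ‖a ^ (k + 1) - b ^ (k + 1)‖
        ≤ ‖a ^ k‖ * ‖a - b‖ + ‖a ^ k - b ^ k‖ * ‖b‖ := by
          rw [h2]
          exact (norm_add_le _ _).trans (add_le_add (norm_mul_le _ _) (norm_mul_le _ _))
      _ ≤ c ^ k * ‖a - b‖ + (k * ‖a - b‖ * c ^ k) * c := by gcongr; exact hpow k
      _ ≤ c ^ (k + 1) * ‖a - b‖ + (k * ‖a - b‖ * c ^ k) * c := by gcongr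
      _ = _ := by push_cast; ring

theorem tendsto_natCast_smul_sub_of_hasDerivAt {R : Type*} [NormedRing R] [NormedAlgebra ℂ R]
    {f : ℂ → R} {A : R} (hf : HasDerivAt f A 0) :
    Tendsto (fun k : ℕ => (k : ℂ) • (f ((k : ℂ)⁻¹) - f 0)) atTop (𝓝 A) := by
  have h1 : Tendsto (fun k : ℕ => ((k : ℂ))⁻¹) atTop (𝓝[≠] 0) := by
    refine tendsto_nhdsWithin_iff.2 ⟨tendsto_inv_atTop_nhds_zero_nat (𝕜 := ℂ), ?_⟩
    filter_upwards [eventually_gt_atTop 0] with k hk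
    simp [hk.ne']
  have h2 := (hasDerivAt_iff_tendsto_slope_zero.1 hf).comp h1
  refine h2.congr fun k => ?_
  simp

/-- Two curves through `1` with the same tangent vector have asymptotically equal `k`-th powers
at time `1 / k`. -/
theorem tendsto_pow_sub_pow_of_hasDerivAt {R : Type*} [NormedRing R] [NormedAlgebra ℂ R]
    (h1 : ‖(1 : R)‖ ≤ 1) {f g : ℂ → R} {A : R} (hf : HasDerivAt f A 0) (hg : HasDerivAt g A 0)
    (hf0 : f 0 = 1) (hg0 : g 0 = 1) :
    Tendsto (fun k : ℕ => f ((k : ℂ)⁻¹) ^ k - g ((k : ℂ)⁻¹) ^ k) atTop (𝓝 0) := by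
  have hbound : ∀ {h : ℂ → R}, HasDerivAt h A 0 → h 0 = 1 →
      ∀ᶠ k : ℕ in atTop, ‖h ((k : ℂ)⁻¹)‖ ≤ 1 + (‖A‖ + 1) / k := by
    intro h hh hh0
    have h2 := (tendsto_natCast_smul_sub_of_hasDerivAt hh).norm
    filter_upwards [h2.eventually_le_const (lt_add_one ‖A‖), eventually_gt_atTop 0] with k hk hk0
    have hk0' : (0 : ℝ) < k := by exact_mod_cast hk0
    rw [norm_smul, Complex.norm_natCast, hh0] at hk
    calc ‖h ((k : ℂ)⁻¹)‖ = ‖1 + (h ((k : ℂ)⁻¹) - 1)‖ := by rw [add_sub_cancel]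
      _ ≤ ‖(1 : R)‖ + ‖h ((k : ℂ)⁻¹) - 1‖ := norm_add_le _ _
      _ ≤ _ := by
        gcongr
        rw [le_div_iff₀ hk0', mul_comm]
        exact hk
  have hlim : Tendsto (fun k : ℕ => (k : ℝ) * ‖f ((k : ℂ)⁻¹) - g ((k : ℂ)⁻¹)‖ *
      Real.exp (‖A‖ + 1)) atTop (𝓝 0) := by
    have h2 := ((tendsto_natCast_smul_sub_of_hasDerivAt hf).sub
      (tendsto_natCast_smul_sub_of_hasDerivAt hg)).norm.mul_const (Real.exp (‖A‖ + 1))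
    simp only [sub_self, norm_zero, zero_mul] at h2
    refine h2.congr fun k => ?_
    rw [← smul_sub, hf0, hg0, sub_sub_sub_cancel_right, norm_smul, Complex.norm_natCast]
  refine squeeze_zero_norm' ?_ hlim
  filter_upwards [hbound hf hf0, hbound hg hg0] with k hkf hkg
  have h3 : (1 : ℝ) ≤ 1 + (‖A‖ + 1) / k := by
    have : 0 ≤ (‖A‖ + 1) / (k : ℝ) := by positivity
    linarith
  refine (norm_pow_sub_pow_le_of_norm_le h1 h3 hkf hkg k).trans ?_
  gcongr
  rcases Nat.eq_zero_or_pos k with rfl | hk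
  · simpa using Real.one_le_exp (by positivity)
  calc (1 + (‖A‖ + 1) / k) ^ k ≤ Real.exp ((‖A‖ + 1) / k) ^ k := by
        gcongr
        rw [add_comm]
        exact Real.add_one_le_exp _
    _ = Real.exp (‖A‖ + 1) := by
        rw [← Real.exp_nat_mul, mul_div_cancel₀ _ (by exact_mod_cast hk.ne')]

theorem Matrix.norm_one_le_one {n : ℕ} : ‖(1 : Matrix (Fin n) (Fin n) ℂ)‖ ≤ 1 := by
  rcases n with _ | n
  · rw [Subsingleton.elim (1 : Matrix (Fin 0) (Fin 0) ℂ) 0]; simp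
  · simp

/-- The **Lie product formula**. -/
theorem tendsto_exp_mul_exp_pow {n : ℕ} (X Y : Matrix (Fin n) (Fin n) ℂ) :
    Tendsto (fun k : ℕ => (NormedSpace.exp ((k : ℂ)⁻¹ • X) * NormedSpace.exp ((k : ℂ)⁻¹ • Y)) ^ k)
      atTop (𝓝 (NormedSpace.exp (X + Y))) := by
  have hX : ∀ X : Matrix (Fin n) (Fin n) ℂ,
      HasDerivAt (fun t : ℂ => NormedSpace.exp (t • X)) X 0 := fun X => by
    have h := hasDerivAt_exp_smul_const' (𝕂 := ℂ) X 0
    rw [zero_smul, NormedSpace.exp_zero, mul_one] at h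
    exact h
  have h1 := (hX X).mul (hX Y)
  simp only [zero_smul, NormedSpace.exp_zero, one_mul, mul_one] at h1
  have h2 := tendsto_pow_sub_pow_of_hasDerivAt Matrix.norm_one_le_one h1 (hX (X + Y))
    (by simp) (by simp)
  rw [← tendsto_sub_nhds_zero_iff]
  refine h2.congr' ?_
  filter_upwards [eventually_gt_atTop 0] with k hk
  have hk' : (k : ℂ) ≠ 0 := by exact_mod_cast hk.ne'
  rw [← Matrix.exp_nsmul, ← Nat.cast_smul_eq_nsmul ℂ, smul_smul, mul_inv_cancel₀ hk', one_smul]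
  rfl

/-- A Zariski closed subgroup contains the invertible limits of its elements. -/
theorem IsZariskiClosedSubgroup.mem_of_tendsto {n : ℕ} {G : Subgroup (GL (Fin n) ℂ)}
    (hG : IsZariskiClosedSubgroup G) {ι : Type*} {l : Filter ι} [l.NeBot] {f : ι → GL (Fin n) ℂ}
    {g : GL (Fin n) ℂ} (hf : ∀ᶠ i in l, f i ∈ G)
    (h : Tendsto (fun i => (f i : Matrix (Fin n) (Fin n) ℂ)) l (𝓝 g)) : g ∈ G := by
  obtain ⟨S, hS⟩ := hG
  refine (hS g).2 fun p hp => ?_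
  have hc : Continuous fun M : Matrix (Fin n) (Fin n) ℂ =>
      MvPolynomial.eval (fun ab : Fin n × Fin n => M ab.1 ab.2) p := by
    refine (MvPolynomial.continuous_eval p).comp ?_
    exact continuous_pi fun ab => continuous_id.matrix_elem ab.1 ab.2
  refine tendsto_nhds_unique ((hc.tendsto _).comp h) (tendsto_const_nhds.congr' ?_)
  filter_upwards [hf] with i hi
  exact ((hS _).1 hi p hp).symm

theorem expGL_zero {n : ℕ} : expGL (0 : Matrix (Fin n) (Fin n) ℂ) = 1 := by
  apply Units.ext
  simp [coe_expGL]

theorem expGL_add_of_commute {n : ℕ} {X Y : Matrix (Fin n) (Fin n) ℂ} (h : Commute X Y) :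
    expGL (X + Y) = expGL X * expGL Y := by
  apply Units.ext
  simp [coe_expGL, Matrix.exp_add_of_commute X Y h]

/-- The adjoint action of `GL_n(ℂ)` on the matrices. -/
def Ad {n : ℕ} : GL (Fin n) ℂ →* Module.End ℂ (Matrix (Fin n) (Fin n) ℂ) where
  toFun g :=
    { toFun := fun X => g * X * (g⁻¹ : GL (Fin n) ℂ)
      map_add' := fun X Y => by rw [mul_add, add_mul]
      map_smul' := fun c X => by simp }
  map_one' := by ext; simp
  map_mul' g h := by ext1 X; simp [mul_assoc]

theorem Ad_apply {n : ℕ} (g : GL (Fin n) ℂ) (X : Matrix (Fin n) (Fin n) ℂ) :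
    Ad g X = g * X * (g⁻¹ : GL (Fin n) ℂ) := rfl

theorem Ad_mul_apply {n : ℕ} (g h : GL (Fin n) ℂ) (X : Matrix (Fin n) (Fin n) ℂ) :
    Ad (g * h) X = Ad g (Ad h X) := by rw [map_mul]; rfl

theorem Ad_one_apply {n : ℕ} (X : Matrix (Fin n) (Fin n) ℂ) : Ad 1 X = X := by rw [map_one]; rfl

theorem Ad_inv_apply_apply {n : ℕ} (g : GL (Fin n) ℂ) (X : Matrix (Fin n) (Fin n) ℂ) :
    Ad g⁻¹ (Ad g X) = X := by rw [← Ad_mul_apply, inv_mul_cancel, Ad_one_apply]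

theorem Ad_apply_inv_apply {n : ℕ} (g : GL (Fin n) ℂ) (X : Matrix (Fin n) (Fin n) ℂ) :
    Ad g (Ad g⁻¹ X) = X := by rw [← Ad_mul_apply, mul_inv_cancel, Ad_one_apply]

theorem Ad_eq_iff_mul_eq {n : ℕ} {g : GL (Fin n) ℂ} {X Y : Matrix (Fin n) (Fin n) ℂ} :
    Ad g X = Y ↔ g * X = Y * g := by
  rw [Ad_apply, Units.mul_inv_eq_iff_eq_mul]

theorem expGL_Ad {n : ℕ} (g : GL (Fin n) ℂ) (X : Matrix (Fin n) (Fin n) ℂ) :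
    expGL (Ad g X) = g * expGL X * g⁻¹ := by
  apply Units.ext
  simpa [coe_expGL, Ad_apply] using Matrix.exp_units_conj g X

theorem Ad_expGL_smul_self {n : ℕ} (l : ℂ) (X : Matrix (Fin n) (Fin n) ℂ) :
    Ad (expGL (l • X)) X = X := by
  rw [Ad_eq_iff_mul_eq, coe_expGL]
  exact ((Commute.refl X).smul_right l).exp_right.symm.eq

/-- The Lie algebra of a Zariski closed subgroup is a complex vector space; closedness under
addition is the Lie product formula. -/
def lieSubmodule {n : ℕ} {G : Subgroup (GL (Fin n) ℂ)} (hG : IsZariskiClosedSubgroup G) :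
    Submodule ℂ (Matrix (Fin n) (Fin n) ℂ) where
  carrier := lieAlg G
  zero_mem' t := by rw [smul_zero, expGL_zero]; exact G.one_mem
  smul_mem' c X hX t := by rw [smul_smul]; exact hX _
  add_mem' {X Y} hX hY t := by
    refine hG.mem_of_tendsto (l := atTop)
      (f := fun k : ℕ => (expGL ((k : ℂ)⁻¹ • t • X) * expGL ((k : ℂ)⁻¹ • t • Y)) ^ k)
      (Eventually.of_forall fun k => ?_) ?_
    · rw [smul_smul, smul_smul]
      exact G.pow_mem (G.mul_mem (hX _) (hY _)) k
    · simpa [coe_expGL] using tendsto_exp_mul_exp_pow (t • X) (t • Y)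

theorem Ad_mem_lieSubmodule {n : ℕ} {G : Subgroup (GL (Fin n) ℂ)} (hG : IsZariskiClosedSubgroup G)
    {g : GL (Fin n) ℂ} (hg : g ∈ G) {X : Matrix (Fin n) (Fin n) ℂ} (hX : X ∈ lieSubmodule hG) :
    Ad g X ∈ lieSubmodule hG := fun t => by
  rw [← map_smul, expGL_Ad]
  exact G.mul_mem (G.mul_mem hg (hX t)) (G.inv_mem hg)

/-- The centralizer `𝔷_𝔤(g)` in the Lie algebra of `G` of an element `g`. -/
def lieCentralizer {n : ℕ} {G : Subgroup (GL (Fin n) ℂ)} (hG : IsZariskiClosedSubgroup G)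
    (g : GL (Fin n) ℂ) : Submodule ℂ (Matrix (Fin n) (Fin n) ℂ) :=
  lieSubmodule hG ⊓ (Ad g).eigenspace 1

theorem mem_lieCentralizer {n : ℕ} {G : Subgroup (GL (Fin n) ℂ)} (hG : IsZariskiClosedSubgroup G)
    {g : GL (Fin n) ℂ} {X : Matrix (Fin n) (Fin n) ℂ} :
    X ∈ lieCentralizer hG g ↔ X ∈ lieSubmodule hG ∧ Ad g X = X := by
  simp [lieCentralizer]

theorem finrank_lieCentralizer_conj {n : ℕ} {G : Subgroup (GL (Fin n) ℂ)}
    (hG : IsZariskiClosedSubgroup G) {g h c : GL (Fin n) ℂ} (hc : c ∈ G) (h1 : g * c = c * h) :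
    Module.finrank ℂ (lieCentralizer hG h) ≤ Module.finrank ℂ (lieCentralizer hG g) := by
  have hinj : Function.Injective (Ad c) := fun X Y hXY => by
    rw [← Ad_inv_apply_apply c X, hXY, Ad_inv_apply_apply]
  refine LinearMap.finrank_le_finrank_of_injective
    (f := (Ad c).restrict (p := lieCentralizer hG h) (q := lieCentralizer hG g) ?_) ?_
  · intro X hX
    rw [mem_lieCentralizer] at hX ⊢
    refine ⟨Ad_mem_lieSubmodule hG hc hX.1, ?_⟩
    rw [← Ad_mul_apply, h1, Ad_mul_apply, hX.2]
  · intro X Y hXY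
    exact Subtype.ext (hinj (congrArg Subtype.val hXY))

/-! ### Holomorphic maps into matrix groups -/

theorem differentiableOn_matrix_iff {n : ℕ} {E : Type*} [NormedAddCommGroup E] [NormedSpace ℂ E]
    {f : E → Matrix (Fin n) (Fin n) ℂ} {s : Set E} :
    DifferentiableOn ℂ f s ↔ ∀ a b, DifferentiableOn ℂ (fun x => f x a b) s := by
  constructor
  · intro h a b
    exact differentiableOn_pi.1 (differentiableOn_pi.1 h a) b
  · intro h
    exact differentiableOn_pi.2 fun a => differentiableOn_pi.2 fun b => h a b

theorem isHolomorphicOn_iff {n : ℕ} {G : Subgroup (GL (Fin n) ℂ)} {E : Type*}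
    [NormedAddCommGroup E] [NormedSpace ℂ E] {g : E → G} {s : Set E} :
    IsHolomorphicOn g s ↔
      DifferentiableOn ℂ (fun x => ((g x : GL (Fin n) ℂ) : Matrix (Fin n) (Fin n) ℂ)) s :=
  differentiableOn_matrix_iff.symm

theorem DifferentiableOn.coe_inv_GL {n : ℕ} {E : Type*} [NormedAddCommGroup E] [NormedSpace ℂ E]
    {g : E → GL (Fin n) ℂ} {s : Set E}
    (h : DifferentiableOn ℂ (fun x => (g x : Matrix (Fin n) (Fin n) ℂ)) s) :
    DifferentiableOn ℂ (fun x => ((g x)⁻¹ : GL (Fin n) ℂ).1) s := by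
  have h1 : DifferentiableOn ℂ
      (fun x => Ring.inverse (g x : Matrix (Fin n) (Fin n) ℂ)) s := fun x hx =>
    (differentiableAt_inverse (𝕜 := ℂ) (g x).isUnit).comp_differentiableWithinAt
      (g := Ring.inverse) x (h x hx)
  exact h1.congr fun x _ => (Ring.inverse_unit (g x)).symm

theorem DifferentiableOn.Ad_apply {n : ℕ} {E : Type*} [NormedAddCommGroup E] [NormedSpace ℂ E]
    {g : E → GL (Fin n) ℂ} {X : E → Matrix (Fin n) (Fin n) ℂ} {s : Set E}
    (h : DifferentiableOn ℂ (fun x => (g x : Matrix (Fin n) (Fin n) ℂ)) s)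
    (hX : DifferentiableOn ℂ X s) : DifferentiableOn ℂ (fun x => Ad (g x) (X x)) s :=
  (h.mul hX).mul h.coe_inv_GL

/-! ### Leading terms of meromorphic families -/

/-- A linear-algebra form of the comparison between a filtered space `V` and its associated graded
space: if the leading terms of the elements of `V` lie in independent subspaces `F k` of a space
`W` that is no larger than `V`, then every element of `F k` is a leading term of degree `k`. -/
theorem exists_leading_eq_of_finrank_le {K V E : Type*} [Field K] [AddCommGroup V] [Module K V]
    [AddCommGroup E] [Module K E] [FiniteDimensional K V] [FiniteDimensional K E]
    (W : Submodule K E) (F : ℤ → Submodule K E) (hF : iSupIndep F) (hFW : ∀ k, F k ≤ W)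
    (D : ℤ → Submodule K V) (lead : ∀ k, D k →ₗ[K] F k)
    (hlead : ∀ v : V, v ≠ 0 → ∃ k, ∃ h : v ∈ D k, lead k ⟨v, h⟩ ≠ 0)
    (hdim : Module.finrank K W ≤ Module.finrank K V) (k : ℤ) (x : F k) :
    ∃ v, lead k v = x := by
  choose ext hext using fun k => (lead k).exists_extend
  have hext' : ∀ k v (h : v ∈ D k), ext k v = lead k ⟨v, h⟩ := fun k v h =>
    LinearMap.congr_fun (hext k) ⟨v, h⟩
  have hfin : {k | F k ≠ ⊥}.Finite := Submodule.finite_ne_bot_of_iSupIndep hF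
  have hbot : ∀ k, k ∉ hfin.toFinset → ∀ y : F k, y = 0 := by
    intro k hk y
    have h1 : F k = ⊥ := by simpa using hk
    exact Subtype.ext ((Submodule.mem_bot K).1 (h1 ▸ y.2))
  -- Each leading-term map is extended linearly, in an arbitrary way, to `V`. Independence of the
  -- `F k` makes the sum `Λ` of the extensions injective, and the dimensions make it bijective.
  let Λ : V →ₗ[K] W := ∑ k ∈ hfin.toFinset, (Submodule.inclusion (hFW k)).comp (ext k)
  have hΛ : ∀ v, (Λ v : E) = ∑ k ∈ hfin.toFinset, (ext k v : E) := by
    intro v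
    simp [Λ, LinearMap.sum_apply]
  have hcomp : ∀ (v : V) (y : ∀ k, F k), (Λ v : E) = ∑ k ∈ hfin.toFinset, (y k : E) →
      ∀ k, ext k v = y k := by
    intro v y h k
    by_cases hk : k ∈ hfin.toFinset
    · rw [hΛ] at h
      exact Subtype.ext ((iSupIndep_iff_finsetSum_eq_imp_eq F).1 hF hfin.toFinset
        (fun k => (ext k v : E)) (fun k => (y k : E)) (fun k _ => ⟨(ext k v).2, (y k).2⟩) h k hk)
    · rw [hbot k hk (ext k v), hbot k hk (y k)]
  have hinj : Function.Injective Λ := by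
    rw [injective_iff_map_eq_zero]
    intro v hv
    by_contra hv0
    obtain ⟨j, hj, hj0⟩ := hlead v hv0
    apply hj0
    rw [← hext' j v hj]
    exact hcomp v (fun _ => 0) (by simp [hv]) j
  have hsurj : Function.Surjective Λ :=
    (LinearMap.injective_iff_surjective_of_finrank_eq_finrank
      (le_antisymm (LinearMap.finrank_le_finrank_of_injective hinj) hdim)).1 hinj
  rcases eq_or_ne x 0 with rfl | hx
  · exact ⟨0, map_zero _⟩
  have hk : k ∈ hfin.toFinset := by
    by_contra h
    exact hx (hbot k h x)
  obtain ⟨v, hv⟩ := hsurj ⟨x, hFW k x.2⟩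
  have hcv : ∀ j, ext j v = (Pi.single k x : ∀ j, F j) j := by
    refine hcomp v _ ?_
    rw [hv, Finset.sum_eq_single_of_mem k hk fun j _ hj => by simp [Pi.single_eq_of_ne hj]]
    simp
  have hv0 : v ≠ 0 := by
    rintro rfl
    apply hx
    have h := hcv k
    rw [map_zero, Pi.single_eq_same] at h
    exact h.symm
  obtain ⟨j, hj, hj0⟩ := hlead v hv0
  rw [← hext' j v hj, hcv j] at hj0
  obtain rfl : j = k := by
    by_contra h
    exact hj0 (Pi.single_eq_of_ne (M := fun j => F j) h x)
  refine ⟨⟨v, hj⟩, ?_⟩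
  rw [← hext' j v hj, hcv j, Pi.single_eq_same]

/-- A holomorphic map on a punctured disc whose norm grows by at most a constant factor when its
argument is contracted by the factor `1 / e` has at most a pole in the centre. -/
theorem meromorphicAt_zero_of_norm_le {E : Type*} [NormedAddCommGroup E] [NormedSpace ℂ E]
    [CompleteSpace E] {f : ℂ → E} {r ρ B : ℝ} (hρ : 0 < ρ) (hρr : ρ < r)
    (hf : DifferentiableOn ℂ f (Metric.ball 0 r \ {0}))
    (hB : ∀ z : ℂ, z ≠ 0 → ‖z‖ ≤ ρ → ‖f (Complex.exp (-1) * z)‖ ≤ B * ‖f z‖) :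
    MeromorphicAt f 0 := by
  obtain ⟨N, hN⟩ := exists_nat_gt B
  have hBN : B ≤ Real.exp N := by linarith [Real.add_one_le_exp (N : ℝ)]
  have hexp : ‖Complex.exp (-1)‖ = Real.exp (-1) := by simp [Complex.norm_exp]
  set h : ℂ → E := fun z => z ^ N • f z with hh
  have hd : DifferentiableOn ℂ h (Metric.ball 0 r \ {0}) :=
    (differentiableOn_id.pow N).smul hf
  have hstep : ∀ z : ℂ, z ≠ 0 → ‖z‖ ≤ ρ → ‖h (Complex.exp (-1) * z)‖ ≤ ‖h z‖ := by
    intro z hz hzρ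
    simp only [hh, norm_smul, norm_pow, norm_mul, hexp, mul_pow]
    calc Real.exp (-1) ^ N * ‖z‖ ^ N * ‖f (Complex.exp (-1) * z)‖
        ≤ Real.exp (-1) ^ N * ‖z‖ ^ N * (Real.exp N * ‖f z‖) := by
          gcongr
          exact (hB z hz hzρ).trans (by gcongr)
      _ = (Real.exp (-1) ^ N * Real.exp N) * (‖z‖ ^ N * ‖f z‖) := by ring
      _ = ‖z‖ ^ N * ‖f z‖ := by
          rw [← Real.exp_nat_mul, ← Real.exp_add]
          simp
  -- `h` is bounded by its maximum `C` on the annulus `ρ / e ≤ |z| ≤ ρ`.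
  have hK : IsCompact (Metric.closedBall (0 : ℂ) ρ \ Metric.ball 0 (Real.exp (-1) * ρ)) :=
    (isCompact_closedBall 0 ρ).diff Metric.isOpen_ball
  have hKs : Metric.closedBall (0 : ℂ) ρ \ Metric.ball 0 (Real.exp (-1) * ρ)
      ⊆ Metric.ball 0 r \ {0} := by
    intro z hz
    simp only [Set.mem_sdiff, Metric.mem_closedBall, dist_zero_right, Metric.mem_ball,
      not_lt] at hz
    have : 0 < Real.exp (-1) * ρ := by positivity
    refine ⟨by simpa using hz.1.trans_lt hρr, ?_⟩
    rintro rfl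
    simp only [norm_zero] at hz
    linarith
  obtain ⟨C, hC⟩ := hK.exists_bound_of_continuousOn (hd.continuousOn.mono hKs)
  have hbd : ∀ m : ℕ, ∀ z : ℂ, Real.exp (-1) ^ (m + 1) * ρ ≤ ‖z‖ → ‖z‖ ≤ ρ → ‖h z‖ ≤ C := by
    intro m
    induction m with
    | zero =>
      intro z h1 h2
      exact hC z ⟨by simpa using h2, by simpa using h1⟩
    | succ m ih =>
      intro z h1 h2
      by_cases h3 : Real.exp (-1) * ρ ≤ ‖z‖
      · exact hC z ⟨by simpa using h2, by simpa using h3⟩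
      have hz : z ≠ 0 := by
        rintro rfl
        rw [norm_zero] at h1
        have : 0 < Real.exp (-1) ^ (m + 1 + 1) * ρ := by positivity
        linarith
      have hw : ‖Complex.exp 1 * z‖ = Real.exp 1 * ‖z‖ := by simp [Complex.norm_exp]
      have hee : Real.exp 1 * Real.exp (-1) = 1 := by rw [← Real.exp_add]; simp
      have h4 : ‖Complex.exp 1 * z‖ ≤ ρ := by
        rw [hw]
        calc Real.exp 1 * ‖z‖ ≤ Real.exp 1 * (Real.exp (-1) * ρ) := by gcongr; linarith
          _ = ρ := by rw [← mul_assoc, hee, one_mul]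
      have h5 : Real.exp (-1) ^ (m + 1) * ρ ≤ ‖Complex.exp 1 * z‖ := by
        rw [hw]
        calc Real.exp (-1) ^ (m + 1) * ρ
            = Real.exp 1 * (Real.exp (-1) ^ (m + 1 + 1) * ρ) := by
              rw [pow_succ _ (m + 1)]
              linear_combination (-Real.exp (-1) ^ (m + 1) * ρ) * hee
          _ ≤ _ := by gcongr
      have h6 := hstep _ (mul_ne_zero (Complex.exp_ne_zero 1) hz) h4
      rw [← mul_assoc, ← Complex.exp_add, neg_add_cancel, Complex.exp_zero, one_mul] at h6
      exact h6.trans (ih _ h5 h4)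
  have hbd' : ∀ z : ℂ, z ≠ 0 → ‖z‖ ≤ ρ → ‖h z‖ ≤ C := by
    intro z hz hzρ
    have hlt : Real.exp (-1) < 1 := by rw [Real.exp_lt_one_iff]; norm_num
    obtain ⟨m, hm⟩ := exists_pow_lt_of_lt_one (div_pos (norm_pos_iff.2 hz) hρ) hlt
    refine hbd m z ?_ hzρ
    rw [lt_div_iff₀ hρ] at hm
    refine le_trans ?_ hm.le
    gcongr ?_ * _
    exact pow_le_pow_of_le_one (Real.exp_nonneg _) hlt.le (Nat.le_succ m)
  refine ⟨N + 1, ?_⟩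
  have heq : (fun z : ℂ => (z - 0) ^ (N + 1) • f z) = fun z => z • h z := by
    ext z
    rw [sub_zero, hh, pow_succ', mul_smul]
  rw [heq]
  refine Complex.analyticAt_of_differentiable_on_punctured_nhds_of_continuousAt ?_ ?_
  · rw [eventually_nhdsWithin_iff]
    filter_upwards [Metric.ball_mem_nhds (0 : ℂ) (hρ.trans hρr)] with z hz hz0
    exact differentiableAt_id.smul ((hd z ⟨hz, hz0⟩).differentiableAt
      ((Metric.isOpen_ball.sdiff isClosed_singleton).mem_nhds ⟨hz, hz0⟩))
  · rw [ContinuousAt, zero_smul]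
    have hlim : Tendsto (fun z : ℂ => ‖z‖ * C) (𝓝 0) (𝓝 0) := by
      have h1 : Tendsto (fun z : ℂ => ‖z‖ * C) (𝓝 0) (𝓝 (‖(0 : ℂ)‖ * C)) :=
        (continuous_norm.mul continuous_const).tendsto 0
      simpa using h1
    refine squeeze_zero_norm' ?_ hlim
    filter_upwards [Metric.closedBall_mem_nhds (0 : ℂ) hρ] with z hz
    rw [norm_smul]
    rcases eq_or_ne z 0 with rfl | hz0
    · simp
    · gcongr
      exact hbd' z hz0 (by simpa using hz)

/-! ### Local cocycles and their invariant sections -/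

/-- The expression of a representation of `ℂ ⋉ 𝔸` in a trivialization over the disc of radius
`radius` around `0`: a holomorphic and multiplicative map with values in `G`, defined on the arrows
whose source and target lie in the disc. (The values of `toFun` at other pairs play no role.) -/
structure LocalCocycle {n : ℕ} (G : Subgroup (GL (Fin n) ℂ)) where
  radius : ℝ
  radius_pos : 0 < radius
  toFun : ℂ × ℂ → G
  holomorphic : IsHolomorphicOn toFun
    {x | x.2 ∈ Metric.ball 0 radius ∧ Complex.exp x.1 * x.2 ∈ Metric.ball 0 radius}
  map_add : ∀ l m z : ℂ, z ∈ Metric.ball 0 radius → Complex.exp m * z ∈ Metric.ball 0 radius →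
    Complex.exp (l + m) * z ∈ Metric.ball 0 radius →
    toFun (l + m, z) = toFun (l, Complex.exp m * z) * toFun (m, z)

theorem tendsto_exp_neg_natCast_mul (z : ℂ) :
    Tendsto (fun m : ℕ => Complex.exp (-m) * z) atTop (𝓝 0) := by
  have h1 : Tendsto (fun m : ℕ => Complex.exp (-m)) atTop (𝓝 0) := by
    have h2 := Real.tendsto_exp_neg_atTop_nhds_zero.comp
      (tendsto_natCast_atTop_atTop (R := ℝ))
    have h3 := (Complex.continuous_ofReal.tendsto 0).comp h2
    rw [Complex.ofReal_zero] at h3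
    exact h3.congr fun m => by simp
  simpa using h1.mul_const z

namespace LocalCocycle

variable {n : ℕ} {G : Subgroup (GL (Fin n) ℂ)} (A : LocalCocycle G)

/-- The disc over which the cocycle is defined. -/
abbrev disc : Set ℂ := Metric.ball 0 A.radius

/-- The values of a cocycle as invertible matrices. -/
def gl (l z : ℂ) : GL (Fin n) ℂ := A.toFun (l, z)

theorem gl_mem (l z : ℂ) : A.gl l z ∈ G := (A.toFun (l, z)).2

theorem zero_mem_disc : (0 : ℂ) ∈ A.disc := Metric.mem_ball_self A.radius_pos

theorem gl_add {l m z : ℂ} (h1 : z ∈ A.disc) (h2 : Complex.exp m * z ∈ A.disc)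
    (h3 : Complex.exp (l + m) * z ∈ A.disc) :
    A.gl (l + m) z = A.gl l (Complex.exp m * z) * A.gl m z := by
  rw [gl, A.map_add l m z h1 h2 h3]; rfl

theorem gl_zero {z : ℂ} (h : z ∈ A.disc) : A.gl 0 z = 1 := by
  have h1 := A.gl_add (l := 0) (m := 0) (z := z) h (by simpa using h) (by simpa using h)
  simpa using h1

theorem gl_add_zero (l m : ℂ) : A.gl (l + m) 0 = A.gl l 0 * A.gl m 0 := by
  simpa using A.gl_add (l := l) (m := m) A.zero_mem_disc (by simpa using A.radius_pos)
    (by simpa using A.radius_pos)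

theorem differentiableOn_gl : DifferentiableOn ℂ
    (fun x : ℂ × ℂ => (A.gl x.1 x.2 : Matrix (Fin n) (Fin n) ℂ))
    {x | x.2 ∈ A.disc ∧ Complex.exp x.1 * x.2 ∈ A.disc} :=
  isHolomorphicOn_iff.1 A.holomorphic

theorem exp_neg_mul_mem_disc {t : ℝ} (ht : 0 ≤ t) {z : ℂ} (hz : z ∈ A.disc) :
    Complex.exp (-t) * z ∈ A.disc := by
  rw [mem_ball_zero_iff] at hz ⊢
  refine lt_of_le_of_lt ?_ hz
  rw [norm_mul]
  refine mul_le_of_le_one_left (norm_nonneg z) ?_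
  rw [Complex.norm_exp]
  simpa using ht

theorem exp_neg_one_mul_mem_disc {z : ℂ} (hz : z ∈ A.disc) : Complex.exp (-1) * z ∈ A.disc := by
  simpa using A.exp_neg_mul_mem_disc zero_le_one hz

theorem exp_neg_natCast_mul_mem_disc (m : ℕ) {z : ℂ} (hz : z ∈ A.disc) :
    Complex.exp (-m) * z ∈ A.disc := by
  simpa using A.exp_neg_mul_mem_disc (t := m) (Nat.cast_nonneg m) hz

/-- For a fixed arrow length `l`, the cocycle is holomorphic in the source. -/
theorem differentiableOn_gl_left (l : ℂ) : DifferentiableOn ℂ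
    (fun z => (A.gl l z : Matrix (Fin n) (Fin n) ℂ))
    {z | z ∈ A.disc ∧ Complex.exp l * z ∈ A.disc} :=
  A.differentiableOn_gl.comp (f := fun z : ℂ => (l, z))
    ((differentiable_const l).prodMk differentiable_id).differentiableOn fun _ hz => hz

theorem continuousAt_gl_zero (l : ℂ) :
    ContinuousAt (fun z => (A.gl l z : Matrix (Fin n) (Fin n) ℂ)) 0 := by
  refine ((A.differentiableOn_gl_left l).differentiableAt ?_).continuousAt
  refine (IsOpen.mem_nhds ?_ ⟨A.zero_mem_disc, by simpa using A.radius_pos⟩)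
  refine Metric.isOpen_ball.inter (Metric.isOpen_ball.preimage ?_)
  fun_prop

theorem continuousAt_gl_inv_zero (l : ℂ) :
    ContinuousAt (fun z => ((A.gl l z)⁻¹ : GL (Fin n) ℂ).1) 0 := by
  refine ((A.differentiableOn_gl_left l).coe_inv_GL.differentiableAt ?_).continuousAt
  refine (IsOpen.mem_nhds ?_ ⟨A.zero_mem_disc, by simpa using A.radius_pos⟩)
  refine Metric.isOpen_ball.inter (Metric.isOpen_ball.preimage ?_)
  fun_prop

/-- The base point of the punctured disc. -/
noncomputable def basePoint : ℂ := ((A.radius / 2 : ℝ) : ℂ)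

theorem basePoint_mem : A.basePoint ∈ A.disc := by
  have := A.radius_pos
  rw [mem_ball_zero_iff, basePoint, Complex.norm_real, Real.norm_of_nonneg (by positivity)]
  linarith

theorem basePoint_ne_zero : A.basePoint ≠ 0 := by
  have := A.radius_pos
  rw [basePoint]
  exact_mod_cast (by positivity : A.radius / 2 ≠ 0)

/-- The monodromy at the base point. -/
noncomputable def baseMonodromy : GL (Fin n) ℂ := A.gl (2 * Real.pi * Complex.I) A.basePoint

/-- The invariant section of the adjoint bundle over the punctured disc with value `Y` at the base
point. It is well defined, independently of the branch of the logarithm, if `Y` commutes with the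
monodromy. (Its value at `z = 0` has no meaning.) -/
noncomputable def invSection (Y : Matrix (Fin n) (Fin n) ℂ) (z : ℂ) : Matrix (Fin n) (Fin n) ℂ :=
  Ad (A.gl (Complex.log (z / A.basePoint)) A.basePoint) Y

theorem Ad_gl_int_mul {Y : Matrix (Fin n) (Fin n) ℂ} (hY : Ad A.baseMonodromy Y = Y) (k : ℤ) :
    Ad (A.gl (k * (2 * Real.pi * Complex.I)) A.basePoint) Y = Y := by
  have hexp : ∀ k : ℤ, Complex.exp (k * (2 * Real.pi * Complex.I)) = 1 := fun k =>
    Complex.exp_int_mul_two_pi_mul_I k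
  have hadd : ∀ k : ℤ, A.gl ((k + 1 : ℤ) * (2 * Real.pi * Complex.I)) A.basePoint
      = A.baseMonodromy * A.gl (k * (2 * Real.pi * Complex.I)) A.basePoint := by
    intro k
    have h := A.gl_add (l := 2 * Real.pi * Complex.I) (m := k * (2 * Real.pi * Complex.I))
      A.basePoint_mem (by rw [hexp, one_mul]; exact A.basePoint_mem)
      (by rw [Complex.exp_add, hexp, Complex.exp_two_pi_mul_I, one_mul, one_mul]
          exact A.basePoint_mem)
    rw [hexp, one_mul] at h
    rw [baseMonodromy, ← h]
    congr 1
    push_cast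
    ring
  induction k using Int.induction_on with
  | zero => simp [A.gl_zero A.basePoint_mem]
  | succ k ih => rw [hadd, Ad_mul_apply, ih, hY]
  | pred k ih =>
    have h := hadd (-k - 1)
    rw [sub_add_cancel] at h
    rw [h, Ad_mul_apply] at ih
    rw [← Ad_inv_apply_apply A.baseMonodromy (Ad _ Y), ih]
    nth_rewrite 1 [← hY]
    rw [Ad_inv_apply_apply]

theorem invSection_eq {Y : Matrix (Fin n) (Fin n) ℂ} (hY : Ad A.baseMonodromy Y = Y) {l z : ℂ}
    (hz : z ∈ A.disc) (hl : Complex.exp l * A.basePoint = z) :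
    A.invSection Y z = Ad (A.gl l A.basePoint) Y := by
  have h0 := A.basePoint_ne_zero
  have hz0 : z / A.basePoint ≠ 0 := by
    rw [← hl, mul_div_cancel_right₀ _ h0]; exact Complex.exp_ne_zero l
  have h1 : Complex.exp l = Complex.exp (Complex.log (z / A.basePoint)) := by
    rw [Complex.exp_log hz0, eq_div_iff h0, hl]
  obtain ⟨k, hk⟩ := Complex.exp_eq_exp_iff_exists_int.1 h1
  have h2 := A.gl_add (l := Complex.log (z / A.basePoint)) (m := k * (2 * Real.pi * Complex.I))
      A.basePoint_mem
      (by rw [Complex.exp_int_mul_two_pi_mul_I, one_mul]; exact A.basePoint_mem)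
      (by rw [← hk, hl]; exact hz)
  rw [hk, h2, Complex.exp_int_mul_two_pi_mul_I, one_mul, Ad_mul_apply, A.Ad_gl_int_mul hY]
  rfl

theorem invSection_exp_mul {Y : Matrix (Fin n) (Fin n) ℂ} (hY : Ad A.baseMonodromy Y = Y) {l z : ℂ}
    (hz : z ∈ A.disc) (hz0 : z ≠ 0) (hl : Complex.exp l * z ∈ A.disc) :
    A.invSection Y (Complex.exp l * z) = Ad (A.gl l z) (A.invSection Y z) := by
  have h0 := A.basePoint_ne_zero
  have hlog : Complex.exp (Complex.log (z / A.basePoint)) * A.basePoint = z := by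
    rw [Complex.exp_log (div_ne_zero hz0 h0), div_mul_cancel₀ _ h0]
  have h1 : Complex.exp (l + Complex.log (z / A.basePoint)) * A.basePoint = Complex.exp l * z := by
    rw [Complex.exp_add, mul_assoc, hlog]
  rw [A.invSection_eq hY hl h1, A.gl_add A.basePoint_mem (hlog.symm ▸ hz) (h1.symm ▸ hl), hlog,
    Ad_mul_apply]
  rfl

theorem invSection_basePoint {Y : Matrix (Fin n) (Fin n) ℂ} (hY : Ad A.baseMonodromy Y = Y) :
    A.invSection Y A.basePoint = Y := by
  rw [A.invSection_eq hY A.basePoint_mem (l := 0) (by simp), A.gl_zero A.basePoint_mem,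
    Ad_one_apply]

theorem differentiableOn_invSection {Y : Matrix (Fin n) (Fin n) ℂ}
    (hY : Ad A.baseMonodromy Y = Y) :
    DifferentiableOn ℂ (A.invSection Y) (A.disc \ {0}) := by
  rintro w ⟨hw, hw0 : w ≠ 0⟩
  refine DifferentiableAt.differentiableWithinAt ?_
  -- Near `w` the section is the transport of its value at `w` along the arrows `log (z / w)`.
  have hcont : ContinuousAt (fun z : ℂ => z / w) w := by fun_prop
  have hslit : ∀ᶠ z in 𝓝 w, z / w ∈ Complex.slitPlane := by
    refine hcont.eventually_mem (Complex.isOpen_slitPlane.mem_nhds ?_)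
    rw [div_self hw0]
    exact Complex.one_mem_slitPlane
  have hexp : ∀ z : ℂ, z ≠ 0 → Complex.exp (Complex.log (z / w)) * w = z := fun z hz => by
    rw [Complex.exp_log (div_ne_zero hz hw0), div_mul_cancel₀ _ hw0]
  have heq : A.invSection Y =ᶠ[𝓝 w]
      fun z => Ad (A.gl (Complex.log (z / w)) w) (A.invSection Y w) := by
    filter_upwards [Metric.isOpen_ball.mem_nhds hw, isOpen_ne.mem_nhds hw0] with z hz hz0
    rw [← A.invSection_exp_mul hY hw hw0 ((hexp z hz0).symm ▸ hz), hexp z hz0]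
  refine DifferentiableAt.congr_of_eventuallyEq ?_ heq
  have hs : IsOpen (A.disc ∩ ({0}ᶜ ∩ (fun z : ℂ => z / w) ⁻¹' Complex.slitPlane)) :=
    Metric.isOpen_ball.inter (isOpen_compl_singleton.inter
      (Complex.isOpen_slitPlane.preimage (by fun_prop)))
  refine DifferentiableOn.differentiableAt (s := _) ?_ (hs.mem_nhds
    ⟨hw, hw0, by simp [div_self hw0]⟩)
  refine DifferentiableOn.Ad_apply ?_ (differentiableOn_const _)
  refine A.differentiableOn_gl.comp (f := fun z : ℂ => (Complex.log (z / w), w)) ?_ ?_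
  · refine DifferentiableOn.prodMk ?_ (differentiableOn_const w)
    exact DifferentiableOn.clog (by fun_prop) fun z hz => hz.2.2
  · intro z hz
    exact ⟨hw, (hexp z hz.2.1).symm ▸ hz.1⟩

/-- Contraction towards `0` by the factor `1 / e` changes an invariant section by the adjoint action
of `A.gl (-1) z`, which is bounded near `0`. -/
theorem meromorphicAt_invSection {Y : Matrix (Fin n) (Fin n) ℂ} (hY : Ad A.baseMonodromy Y = Y) :
    MeromorphicAt (A.invSection Y) 0 := by
  have hr := A.radius_pos
  have hsub : Metric.closedBall (0 : ℂ) (A.radius / 2) ⊆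
      {z | z ∈ A.disc ∧ Complex.exp (-1) * z ∈ A.disc} := by
    intro z hz
    have hz' : z ∈ A.disc := by
      rw [mem_closedBall_zero_iff] at hz
      rw [mem_ball_zero_iff]
      linarith
    exact ⟨hz', A.exp_neg_one_mul_mem_disc hz'⟩
  obtain ⟨B, hB⟩ := (isCompact_closedBall (0 : ℂ) (A.radius / 2)).exists_bound_of_continuousOn
    ((A.differentiableOn_gl_left (-1)).continuousOn.mono hsub)
  obtain ⟨C, hC⟩ := (isCompact_closedBall (0 : ℂ) (A.radius / 2)).exists_bound_of_continuousOn
    ((A.differentiableOn_gl_left (-1)).coe_inv_GL.continuousOn.mono hsub)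
  refine meromorphicAt_zero_of_norm_le (ρ := A.radius / 2) (B := B * C) (by linarith)
    (by linarith) (A.differentiableOn_invSection hY) fun z hz0 hz => ?_
  have hz' : z ∈ Metric.closedBall (0 : ℂ) (A.radius / 2) := by simpa using hz
  rw [A.invSection_exp_mul hY (hsub hz').1 hz0 (hsub hz').2, Ad_apply]
  have hB0 : 0 ≤ B := (norm_nonneg _).trans (hB z hz')
  calc _ ≤ ‖(A.gl (-1) z : Matrix (Fin n) (Fin n) ℂ)‖ * ‖A.invSection Y z‖ *
        ‖((A.gl (-1) z)⁻¹ : GL (Fin n) ℂ).1‖ :=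
        (norm_mul_le _ _).trans (mul_le_mul_of_nonneg_right (norm_mul_le _ _) (norm_nonneg _))
    _ ≤ B * ‖A.invSection Y z‖ * C := by
        gcongr
        · exact hB z hz'
        · exact hC z hz'
    _ = _ := by ring

/-- `c` is the leading coefficient of degree `k` of the invariant section through `Y`; it is `0` if
the section vanishes to higher order. -/
def HasLeadingCoeff (k : ℤ) (Y c : Matrix (Fin n) (Fin n) ℂ) : Prop :=
  Tendsto (fun z : ℂ => z ^ (-k) • A.invSection Y z) (𝓝[≠] 0) (𝓝 c)

variable {A}

theorem HasLeadingCoeff.add {k : ℤ} {Y c Y' c' : Matrix (Fin n) (Fin n) ℂ}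
    (h : A.HasLeadingCoeff k Y c) (h' : A.HasLeadingCoeff k Y' c') :
    A.HasLeadingCoeff k (Y + Y') (c + c') :=
  (Tendsto.add h h').congr fun z => by
    rw [← smul_add, invSection, invSection, ← _root_.map_add]; rfl

theorem HasLeadingCoeff.smul {k : ℤ} {Y c : Matrix (Fin n) (Fin n) ℂ} (a : ℂ)
    (h : A.HasLeadingCoeff k Y c) : A.HasLeadingCoeff k (a • Y) (a • c) :=
  (Tendsto.const_smul h a).congr fun z => by rw [smul_comm, invSection, ← map_smul]; rfl

theorem HasLeadingCoeff.Ad_eq {k : ℤ} {Y c : Matrix (Fin n) (Fin n) ℂ}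
    (h : A.HasLeadingCoeff k Y c) (hY : Ad A.baseMonodromy Y = Y) (l : ℂ) :
    Ad (A.gl l 0) c = Complex.exp l ^ k • c := by
  have hl : Complex.exp l ≠ 0 := Complex.exp_ne_zero l
  have hcont : Tendsto (fun z : ℂ => Complex.exp l * z) (𝓝[≠] 0) (𝓝[≠] 0) := by
    refine tendsto_nhdsWithin_iff.2 ⟨?_, ?_⟩
    · have h1 : Tendsto (fun z : ℂ => Complex.exp l * z) (𝓝 0) (𝓝 (Complex.exp l * 0)) :=
        (continuous_const.mul continuous_id).tendsto 0
      rw [mul_zero] at h1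
      exact h1.mono_left nhdsWithin_le_nhds
    · filter_upwards [self_mem_nhdsWithin] with z hz
      exact mul_ne_zero hl hz
  have h1 : Tendsto (fun z : ℂ => Ad (A.gl l z) (z ^ (-k) • A.invSection Y z)) (𝓝[≠] 0)
      (𝓝 (Ad (A.gl l 0) c)) :=
    (((A.continuousAt_gl_zero l).tendsto.mono_left nhdsWithin_le_nhds).mul h).mul
      ((A.continuousAt_gl_inv_zero l).tendsto.mono_left nhdsWithin_le_nhds)
  have h2 : Tendsto (fun z : ℂ => Complex.exp l ^ k •
      ((Complex.exp l * z) ^ (-k) • A.invSection Y (Complex.exp l * z))) (𝓝[≠] 0)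
      (𝓝 (Complex.exp l ^ k • c)) := (h.comp hcont).const_smul _
  refine tendsto_nhds_unique h1 (h2.congr' ?_)
  have hd : ∀ᶠ z in 𝓝[≠] (0 : ℂ), z ∈ A.disc :=
    nhdsWithin_le_nhds (Metric.isOpen_ball.mem_nhds A.zero_mem_disc)
  filter_upwards [hd, hcont.eventually hd, self_mem_nhdsWithin] with z hz hlz hz0
  rw [A.invSection_exp_mul hY hz hz0 hlz, map_smul, mul_zpow, smul_smul, ← mul_assoc,
    ← zpow_add₀ hl, add_neg_cancel, zpow_zero, one_mul]

theorem HasLeadingCoeff.mem_lieCentralizer (hG : IsZariskiClosedSubgroup G) {k : ℤ}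
    {Y c : Matrix (Fin n) (Fin n) ℂ} (h : A.HasLeadingCoeff k Y c)
    (hY : Y ∈ lieCentralizer hG A.baseMonodromy) :
    c ∈ lieCentralizer hG (A.gl (2 * Real.pi * Complex.I) 0) := by
  rw [_root_.mem_lieCentralizer] at hY ⊢
  constructor
  · refine (Submodule.closed_of_finiteDimensional (lieSubmodule hG)).mem_of_tendsto h
      (Eventually.of_forall fun z => ?_)
    exact (lieSubmodule hG).smul_mem _ (Ad_mem_lieSubmodule hG (A.gl_mem _ _) hY.1)
  · rw [h.Ad_eq hY.2, Complex.exp_two_pi_mul_I, one_zpow, one_smul]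

/-- A nonzero invariant section has a nonzero leading coefficient: it is meromorphic, and cannot
vanish near `0`, because the flow carries every point towards `0`. -/
theorem exists_hasLeadingCoeff_ne_zero {Y : Matrix (Fin n) (Fin n) ℂ}
    (hY : Ad A.baseMonodromy Y = Y) (hY0 : Y ≠ 0) :
    ∃ k c, A.HasLeadingCoeff k Y c ∧ c ≠ 0 := by
  have hmer := A.meromorphicAt_invSection hY
  have hord : meromorphicOrderAt (A.invSection Y) 0 ≠ ⊤ := by
    intro htop
    rw [meromorphicOrderAt_eq_top_iff, eventually_nhdsWithin_iff] at htop
    -- The orbit `exp (-m) * basePoint` of the base point tends to `0`.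
    obtain ⟨m, hm⟩ := ((tendsto_exp_neg_natCast_mul A.basePoint).eventually htop).exists
    have hm' := A.exp_neg_natCast_mul_mem_disc m A.basePoint_mem
    have h4 := hm (mul_ne_zero (Complex.exp_ne_zero _) A.basePoint_ne_zero)
    rw [A.invSection_exp_mul hY A.basePoint_mem A.basePoint_ne_zero hm',
      A.invSection_basePoint hY] at h4
    apply hY0
    rw [← Ad_inv_apply_apply _ Y, h4, map_zero]
  obtain ⟨g, hg, hg0, heq⟩ := (meromorphicOrderAt_ne_top_iff hmer).1 hord
  refine ⟨(meromorphicOrderAt (A.invSection Y) 0).untop₀, g 0, ?_, hg0⟩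
  refine (hg.continuousAt.tendsto.mono_left nhdsWithin_le_nhds).congr' ?_
  filter_upwards [heq, self_mem_nhdsWithin] with z hz hz0
  rw [hz, sub_zero, smul_smul, ← zpow_add₀ hz0, neg_add_cancel, zpow_zero, one_smul]

/-- If the centralizer of the monodromy around `0` is at least as large as the centralizer of the
monodromy at `0`, then every element of the Lie algebra that is invariant at `0` is the limit of an
invariant section: the leading terms of the invariant sections must exhaust the centralizer at
`0`. -/
theorem exists_tendsto_invSection (hG : IsZariskiClosedSubgroup G)
    (hdim : Module.finrank ℂ (lieCentralizer hG (A.gl (2 * Real.pi * Complex.I) 0)) ≤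
      Module.finrank ℂ (lieCentralizer hG A.baseMonodromy))
    {R : Matrix (Fin n) (Fin n) ℂ} (hR : R ∈ lieSubmodule hG)
    (hinv : ∀ l, Ad (A.gl l 0) R = R) :
    ∃ Y ∈ lieCentralizer hG A.baseMonodromy,
      Tendsto (A.invSection Y) (𝓝[≠] 0) (𝓝 R) := by
  -- A leading coefficient `c` of degree `k` satisfies `Ad (A.gl l 0) c = exp l ^ k • c` for all
  -- `l`. Taking `l = 2πi` puts it into the centralizer, and `l = 1` separates the degrees.
  let F : ℤ → Submodule ℂ (Matrix (Fin n) (Fin n) ℂ) := fun k =>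
    lieCentralizer hG (A.gl (2 * Real.pi * Complex.I) 0) ⊓
      (Ad (A.gl 1 0)).eigenspace (Complex.exp 1 ^ k)
  have hF : iSupIndep F := by
    refine iSupIndep.mono ?_ fun k => inf_le_right
    refine (Module.End.eigenspaces_iSupIndep (Ad (A.gl 1 0))).comp fun j k hjk => ?_
    have h1 := congrArg norm hjk
    simp only [norm_zpow, Complex.norm_exp, Complex.one_re] at h1
    exact zpow_right_injective₀ (Real.exp_pos 1) (by simp) h1
  let D : ℤ → Submodule ℂ (lieCentralizer hG A.baseMonodromy) := fun k =>
    { carrier := {Y | ∃ c, A.HasLeadingCoeff k Y c}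
      zero_mem' := ⟨0, by simp [HasLeadingCoeff, invSection]⟩
      add_mem' := fun ⟨c, hc⟩ ⟨d, hd⟩ => ⟨c + d, hc.add hd⟩
      smul_mem' := fun a _ ⟨c, hc⟩ => ⟨a • c, hc.smul a⟩ }
  have hmem : ∀ k (Y : D k) c, A.HasLeadingCoeff k Y.1 c → c ∈ F k := fun k Y c hc =>
    ⟨hc.mem_lieCentralizer hG Y.1.2, 
      Module.End.mem_eigenspace_iff.2 (hc.Ad_eq ((mem_lieCentralizer hG).1 Y.1.2).2 1)⟩
  let lead : ∀ k, D k →ₗ[ℂ] F k := fun k =>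
    { toFun := fun Y => ⟨Y.2.choose, hmem k Y _ Y.2.choose_spec⟩
      map_add' := fun Y Z => Subtype.ext (tendsto_nhds_unique (Y + Z).2.choose_spec
        (Y.2.choose_spec.add Z.2.choose_spec))
      map_smul' := fun a Y => Subtype.ext (tendsto_nhds_unique (a • Y).2.choose_spec
        (Y.2.choose_spec.smul a)) }
  have hlead : ∀ v : lieCentralizer hG A.baseMonodromy, v ≠ 0 →
      ∃ k, ∃ h : v ∈ D k, lead k ⟨v, h⟩ ≠ 0 := by
    intro v hv
    obtain ⟨k, c, hc, hc0⟩ := exists_hasLeadingCoeff_ne_zero ((mem_lieCentralizer hG).1 v.2).2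
      (fun h => hv (Subtype.ext h))
    refine ⟨k, ⟨c, hc⟩, fun h => hc0 ?_⟩
    have hv' : v ∈ D k := ⟨c, hc⟩
    rw [← tendsto_nhds_unique hv'.choose_spec hc]
    exact congrArg Subtype.val h
  have hRF : R ∈ F 0 := by
    refine ⟨(mem_lieCentralizer hG).2 ⟨hR, hinv _⟩, Module.End.mem_eigenspace_iff.2 ?_⟩
    rw [hinv, zpow_zero, one_smul]
  obtain ⟨Y, hY⟩ := exists_leading_eq_of_finrank_le _ F hF (fun k => inf_le_left) D lead hlead
    hdim 0 ⟨R, hRF⟩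
  refine ⟨Y.1, Y.1.2, ?_⟩
  have h1 : A.HasLeadingCoeff 0 Y.1 Y.2.choose := Y.2.choose_spec
  have h2 : Y.2.choose = R := congrArg Subtype.val hY
  rw [h2] at h1
  simpa [HasLeadingCoeff] using h1

/-- Under the same hypothesis, an element of the Lie algebra that is invariant at `0` extends to a
holomorphic invariant section of the adjoint bundle over the disc. -/
theorem exists_invariant_section (hG : IsZariskiClosedSubgroup G)
    (hdim : Module.finrank ℂ (lieCentralizer hG (A.gl (2 * Real.pi * Complex.I) 0)) ≤
      Module.finrank ℂ (lieCentralizer hG A.baseMonodromy))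
    {R : Matrix (Fin n) (Fin n) ℂ} (hR : R ∈ lieSubmodule hG)
    (hinv : ∀ l, Ad (A.gl l 0) R = R) :
    ∃ X : ℂ → Matrix (Fin n) (Fin n) ℂ, DifferentiableOn ℂ X A.disc ∧ X 0 = R ∧
      (∀ z, X z ∈ lieSubmodule hG) ∧
      ∀ l z, z ∈ A.disc → Complex.exp l * z ∈ A.disc →
        X (Complex.exp l * z) = Ad (A.gl l z) (X z) := by
  obtain ⟨Y, hY, hlim⟩ := A.exists_tendsto_invSection hG hdim hR hinv
  rw [mem_lieCentralizer] at hY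
  refine ⟨Function.update (A.invSection Y) 0 R, ?_, Function.update_self _ _ _, ?_, ?_⟩
  · refine (Complex.differentiableOn_compl_singleton_and_continuousAt_iff
      (Metric.isOpen_ball.mem_nhds A.zero_mem_disc)).1
      ⟨(A.differentiableOn_invSection hY.2).congr fun z hz => Function.update_of_ne hz.2 _ _, ?_⟩
    exact continuousAt_update_same.2 hlim
  · intro z
    rcases eq_or_ne z 0 with rfl | hz
    · rwa [Function.update_self]
    · rw [Function.update_of_ne hz]
      exact Ad_mem_lieSubmodule hG (A.gl_mem _ _) hY.1
  · intro l z hz hlz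
    rcases eq_or_ne z 0 with rfl | hz0
    · rw [mul_zero, Function.update_self, hinv]
    · rw [Function.update_of_ne hz0,
        Function.update_of_ne (mul_ne_zero (Complex.exp_ne_zero l) hz0),
        A.invSection_exp_mul hY.2 hz hz0 hlz]

end LocalCocycle

/-! ### Linearization over a disc -/

/-- A sequence of holomorphic maps whose successive relative changes are summable converges
pointwise to a holomorphic map. -/
theorem exists_differentiableOn_tendsto_of_norm_sub_le {E : Type*} [NormedAddCommGroup E]
    [NormedSpace ℂ E] [CompleteSpace E] {s : Set ℂ} (hs : IsOpen s) {a : ℕ → ℂ → E} {ε : ℕ → ℝ}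
    (hε0 : ∀ m, 0 ≤ ε m) (hε : Summable ε) (ha : ∀ m, DifferentiableOn ℂ (a m) s)
    (h0 : ∀ z ∈ s, ‖a 0 z‖ ≤ 1)
    (hstep : ∀ m, ∀ z ∈ s, ‖a (m + 1) z - a m z‖ ≤ ε m * ‖a m z‖) :
    ∃ b : ℂ → E, DifferentiableOn ℂ b s ∧ ∀ z ∈ s, Tendsto (fun m => a m z) atTop (𝓝 (b z)) := by
  have hbd : ∀ m, ∀ z ∈ s, ‖a m z‖ ≤ Real.exp (∑ j ∈ Finset.range m, ε j) := by
    intro m z hz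
    induction m with
    | zero => simpa using h0 z hz
    | succ m ih =>
      calc ‖a (m + 1) z‖ = ‖(a (m + 1) z - a m z) + a m z‖ := by rw [sub_add_cancel]
        _ ≤ ε m * ‖a m z‖ + ‖a m z‖ := (norm_add_le _ _).trans (by gcongr; exact hstep m z hz)
        _ = (ε m + 1) * ‖a m z‖ := by ring
        _ ≤ Real.exp (ε m) * Real.exp (∑ j ∈ Finset.range m, ε j) := by
          gcongr
          exact Real.add_one_le_exp _
        _ = _ := by rw [← Real.exp_add, Finset.sum_range_succ, add_comm]
  have hbd' : ∀ m, ∀ z ∈ s, ‖a (m + 1) z - a m z‖ ≤ ε m * Real.exp (∑' j, ε j) := by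
    intro m z hz
    refine (hstep m z hz).trans (mul_le_mul_of_nonneg_left ((hbd m z hz).trans ?_) (hε0 m))
    exact Real.exp_le_exp.2 (hε.sum_le_tsum _ fun j _ => hε0 j)
  -- The Weierstrass test, applied to the telescoping series.
  have hunif := tendstoUniformlyOn_tsum_nat (hε.mul_right (Real.exp (∑' j, ε j))) hbd'
  refine ⟨fun z => a 0 z + ∑' m, (a (m + 1) z - a m z), (ha 0).add ?_, fun z hz => ?_⟩
  · refine hunif.tendstoLocallyUniformlyOn.differentiableOn (Eventually.of_forall fun N => ?_) hs
    exact DifferentiableOn.fun_sum fun m _ => (ha (m + 1)).sub (ha m)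
  · refine ((hunif.tendsto_at hz).const_add (a 0 z)).congr fun N => ?_
    rw [Finset.sum_range_sub (fun m => a m z), add_sub_cancel]

theorem DifferentiableOn.expGL {n : ℕ} {E : Type*} [NormedAddCommGroup E] [NormedSpace ℂ E]
    {X : E → Matrix (Fin n) (Fin n) ℂ} {s : Set E} (h : DifferentiableOn ℂ X s) :
    DifferentiableOn ℂ (fun x => (expGL (X x) : Matrix (Fin n) (Fin n) ℂ)) s := fun x hx =>
  ((NormedSpace.exp_analytic (𝕂 := ℂ) (X x)).differentiableAt).comp_differentiableWithinAt
    (g := NormedSpace.exp) x (h x hx)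

namespace LocalCocycle

variable {n : ℕ} {G : Subgroup (GL (Fin n) ℂ)} (A : LocalCocycle G)

/-- A cocycle that is trivial at `0` is a coboundary near `0`: transporting a point to `0` along
the real flow, as `t → -∞`, gives the trivialization. -/
theorem exists_trivialization (hG : IsZariskiClosedSubgroup G) (h1 : ∀ l, A.gl l 0 = 1) :
    ∃ ρ, 0 < ρ ∧ ρ ≤ A.radius ∧ ∃ T : ℂ → GL (Fin n) ℂ,
      (∀ z ∈ Metric.ball 0 ρ, T z ∈ G) ∧
      DifferentiableOn ℂ (fun z => (T z : Matrix (Fin n) (Fin n) ℂ)) (Metric.ball 0 ρ) ∧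
      T 0 = 1 ∧ ∀ l : ℂ, ∀ z ∈ Metric.ball 0 ρ, Complex.exp l * z ∈ Metric.ball 0 ρ →
        T (Complex.exp l * z) * A.gl l z = T z := by
  have hnhds : {z | z ∈ A.disc ∧ Complex.exp (-1) * z ∈ A.disc} ∈ 𝓝 (0 : ℂ) := by
    filter_upwards [Metric.isOpen_ball.mem_nhds A.zero_mem_disc] with z hz
    exact ⟨hz, A.exp_neg_one_mul_mem_disc hz⟩
  obtain ⟨C, hC⟩ := (((A.differentiableOn_gl_left (-1)).differentiableAt hnhds).isBigO_sub).bound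
  obtain ⟨C', hC'⟩ :=
    (((A.differentiableOn_gl_left (-1)).coe_inv_GL.differentiableAt hnhds).isBigO_sub).bound
  simp only [h1, sub_zero, inv_one, Units.val_one] at hC hC'
  obtain ⟨ρ₀, hρ₀, hball⟩ := Metric.eventually_nhds_iff_ball.1 (hC.and hC')
  set ρ := min ρ₀ A.radius with hρdef
  have hρ : 0 < ρ := lt_min hρ₀ A.radius_pos
  have hsub : Metric.ball (0 : ℂ) ρ ⊆ A.disc := Metric.ball_subset_ball (min_le_right _ _)
  have hsub' : Metric.ball (0 : ℂ) ρ ⊆ Metric.ball 0 ρ₀ := Metric.ball_subset_ball (min_le_left _ _)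
  have hnorm : ∀ (m : ℕ) (z : ℂ), ‖Complex.exp (-m) * z‖ = Real.exp (-1) ^ m * ‖z‖ := by
    intro m z
    rw [norm_mul, Complex.norm_exp, ← Real.exp_nat_mul]
    simp
  have hlt : Real.exp (-1) < 1 := by rw [Real.exp_lt_one_iff]; norm_num
  have hmem : ∀ (m : ℕ), ∀ z ∈ Metric.ball (0 : ℂ) ρ, Complex.exp (-m) * z ∈ Metric.ball 0 ρ := by
    intro m z hz
    rw [mem_ball_zero_iff] at hz ⊢
    rw [hnorm]
    exact (mul_le_of_le_one_left (norm_nonneg z)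
      (pow_le_one₀ (Real.exp_nonneg _) hlt.le)).trans_lt hz
  let D := max (max C C') 0
  let ε : ℕ → ℝ := fun m => D * ρ * Real.exp (-1) ^ m
  have hD : 0 ≤ D := le_max_right _ _
  have hε0 : ∀ m, 0 ≤ ε m := fun m => by positivity
  have hε : Summable ε := (summable_geometric_of_lt_one (Real.exp_nonneg _) hlt).mul_left _
  have hbound : ∀ (m : ℕ), ∀ z ∈ Metric.ball (0 : ℂ) ρ,
      ‖(A.gl (-1) (Complex.exp (-m) * z) : Matrix (Fin n) (Fin n) ℂ) - 1‖ ≤ ε m ∧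
      ‖((A.gl (-1) (Complex.exp (-m) * z))⁻¹ : GL (Fin n) ℂ).1 - 1‖ ≤ ε m := by
    intro m z hz
    have h2 := hball _ (hsub' (hmem m z hz))
    rw [hnorm] at h2
    have hzρ : ‖z‖ ≤ ρ := (mem_ball_zero_iff.1 hz).le
    have h3 : ∀ c ≤ D, c * (Real.exp (-1) ^ m * ‖z‖) ≤ ε m := fun c hc => by
      calc c * (Real.exp (-1) ^ m * ‖z‖) ≤ D * (Real.exp (-1) ^ m * ρ) := by gcongr
        _ = ε m := by simp only [ε]; ring
    exact ⟨h2.1.trans (h3 C ((le_max_left _ _).trans (le_max_left _ _))),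
      h2.2.trans (h3 C' ((le_max_right _ _).trans (le_max_left _ _)))⟩
  have hsucc : ∀ (m : ℕ), ∀ z ∈ Metric.ball (0 : ℂ) ρ,
      A.gl (-(m + 1 : ℕ)) z = A.gl (-1) (Complex.exp (-m) * z) * A.gl (-m) z := by
    intro m z hz
    have h4 : (-(m + 1 : ℕ) : ℂ) = -1 + -m := by push_cast; ring
    rw [h4]
    refine A.gl_add (hsub hz) (hsub (hmem m z hz)) ?_
    rw [← h4]
    exact hsub (hmem (m + 1) z hz)
  have hdiff : ∀ m : ℕ, DifferentiableOn ℂ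
      (fun z => (A.gl (-m) z : Matrix (Fin n) (Fin n) ℂ)) (Metric.ball 0 ρ) := fun m =>
    (A.differentiableOn_gl_left (-m)).mono fun z hz => ⟨hsub hz, hsub (hmem m z hz)⟩
  have hstart : ∀ z ∈ Metric.ball (0 : ℂ) ρ, A.gl (-(0 : ℕ)) z = 1 := fun z hz => by
    rw [Nat.cast_zero, neg_zero, A.gl_zero (hsub hz)]
  obtain ⟨P, hPd, hP⟩ := exists_differentiableOn_tendsto_of_norm_sub_le Metric.isOpen_ball hε0 hε
    hdiff (fun z hz => by rw [hstart z hz]; exact Matrix.norm_one_le_one)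
    (fun m z hz => by
      rw [hsucc m z hz, Units.val_mul, ← sub_one_mul]
      exact (norm_mul_le _ _).trans (by gcongr; exact (hbound m z hz).1))
  obtain ⟨Q, -, hQ⟩ := exists_differentiableOn_tendsto_of_norm_sub_le Metric.isOpen_ball hε0 hε
    (fun m => (hdiff m).coe_inv_GL)
    (fun z hz => by rw [hstart z hz, inv_one]; exact Matrix.norm_one_le_one)
    (fun m z hz => by
      rw [hsucc m z hz, mul_inv_rev, Units.val_mul, ← mul_sub_one, mul_comm (ε m)]
      exact (norm_mul_le _ _).trans (by gcongr; exact (hbound m z hz).2))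
  have hPQ : ∀ z ∈ Metric.ball (0 : ℂ) ρ, P z * Q z = 1 := fun z hz =>
    tendsto_nhds_unique ((hP z hz).mul (hQ z hz)) (tendsto_const_nhds.congr fun m => by simp)
  have hQP : ∀ z ∈ Metric.ball (0 : ℂ) ρ, Q z * P z = 1 := fun z hz =>
    tendsto_nhds_unique ((hQ z hz).mul (hP z hz)) (tendsto_const_nhds.congr fun m => by simp)
  classical
  let T : ℂ → GL (Fin n) ℂ := fun z =>
    if hz : z ∈ Metric.ball (0 : ℂ) ρ then ⟨P z, Q z, hPQ z hz, hQP z hz⟩ else 1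
  have hT : ∀ z ∈ Metric.ball (0 : ℂ) ρ, (T z : Matrix (Fin n) (Fin n) ℂ) = P z := fun z hz => by
    simp only [T, dif_pos hz]
  refine ⟨ρ, hρ, min_le_right _ _, T, fun z hz => ?_, hPd.congr hT, ?_, fun l z hz hlz => ?_⟩
  · refine hG.mem_of_tendsto (l := atTop) (f := fun m : ℕ => A.gl (-m) z)
      (Eventually.of_forall fun m => A.gl_mem _ _) ?_
    rw [hT z hz]
    exact hP z hz
  · have h0 : (0 : ℂ) ∈ Metric.ball (0 : ℂ) ρ := Metric.mem_ball_self hρ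
    apply Units.ext
    rw [hT 0 h0]
    refine tendsto_nhds_unique (hP 0 h0) (tendsto_const_nhds.congr fun m => ?_)
    rw [h1]
  · apply Units.ext
    rw [Units.val_mul, hT _ hlz, hT z hz]
    have hlim : Tendsto (fun m : ℕ =>
        (A.gl l (Complex.exp (-m) * z) : Matrix (Fin n) (Fin n) ℂ) * A.gl (-m) z)
        atTop (𝓝 (P z)) := by
      have h5 := (((A.continuousAt_gl_zero l).tendsto.comp (tendsto_exp_neg_natCast_mul z)).mul
        (hP z hz))
      rw [h1, Units.val_one, one_mul] at h5
      exact h5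
    refine tendsto_nhds_unique ((hP _ hlz).mul_const _) (hlim.congr fun m => ?_)
    have hd : Complex.exp (-m + l) * z ∈ A.disc := by
      rw [Complex.exp_add, mul_assoc]
      exact hsub (hmem m _ hlz)
    have h6 := A.gl_add (l := -m) (m := l) (hsub hz) (hsub hlz) hd
    have h7 := A.gl_add (l := l) (m := -m) (hsub hz) (hsub (hmem m z hz))
      (by rwa [add_comm] at hd)
    rw [← Units.val_mul, ← Units.val_mul, ← h6, ← h7, add_comm]

/-- The cocycle `A(l, z) exp(-l X(z))`, for an invariant section `X` of the adjoint bundle. -/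
noncomputable def twist (hG : IsZariskiClosedSubgroup G) (X : ℂ → Matrix (Fin n) (Fin n) ℂ)
    (hXd : DifferentiableOn ℂ X A.disc) (hX : ∀ z, X z ∈ lieSubmodule hG)
    (hinv : ∀ l z, z ∈ A.disc → Complex.exp l * z ∈ A.disc →
      X (Complex.exp l * z) = Ad (A.gl l z) (X z)) : LocalCocycle G where
  radius := A.radius
  radius_pos := A.radius_pos
  toFun x := A.toFun x * ⟨expGL (-x.1 • X x.2), hX x.2 _⟩
  holomorphic := by
    refine isHolomorphicOn_iff.2 (A.differentiableOn_gl.mul (DifferentiableOn.expGL ?_))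
    refine DifferentiableOn.smul (c := fun x : ℂ × ℂ => -x.1) differentiableOn_fst.neg ?_
    exact hXd.comp differentiableOn_snd fun x hx => hx.1
  map_add l m z h1 h2 h3 := by
    rw [A.map_add l m z h1 h2 h3]
    apply Subtype.ext
    simp only [Subgroup.coe_mul]
    have h4 : expGL (-l • X (Complex.exp m * z))
        = A.gl m z * expGL (-l • X z) * (A.gl m z)⁻¹ := by
      rw [hinv m z h1 h2, ← map_smul, expGL_Ad]
    have h5 : expGL (-(l + m) • X z) = expGL (-l • X z) * expGL (-m • X z) := by
      rw [← expGL_add_of_commute (((Commute.refl (X z)).smul_left _).smul_right _), ← add_smul,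
        neg_add]
    rw [h4, h5]
    simp only [gl, mul_assoc, inv_mul_cancel_left]

theorem twist_gl (hG : IsZariskiClosedSubgroup G) (X : ℂ → Matrix (Fin n) (Fin n) ℂ)
    (hXd : DifferentiableOn ℂ X A.disc) (hX : ∀ z, X z ∈ lieSubmodule hG)
    (hinv : ∀ l z, z ∈ A.disc → Complex.exp l * z ∈ A.disc →
      X (Complex.exp l * z) = Ad (A.gl l z) (X z)) (l z : ℂ) :
    (A.twist hG X hXd hX hinv).gl l z = A.gl l z * expGL (-l • X z) := rfl

/-- If the residue extends to an invariant section of the adjoint bundle, the cocycle is equivalent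
near `0` to the constant one: after dividing by the exponential of the section, the residue is `0`;
in a trivialization of the resulting cocycle the section is invariant under dilations, hence
constant. -/
theorem exists_linearization_of_invariant_section (hG : IsZariskiClosedSubgroup G)
    {R : Matrix (Fin n) (Fin n) ℂ} (hR : ∀ l, A.gl l 0 = expGL (l • R))
    (X : ℂ → Matrix (Fin n) (Fin n) ℂ) (hXd : DifferentiableOn ℂ X A.disc) (hX0 : X 0 = R)
    (hX : ∀ z, X z ∈ lieSubmodule hG)
    (hinv : ∀ l z, z ∈ A.disc → Complex.exp l * z ∈ A.disc →
      X (Complex.exp l * z) = Ad (A.gl l z) (X z)) :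
    ∃ ρ, 0 < ρ ∧ ρ ≤ A.radius ∧ ∃ S : ℂ → G, IsHolomorphicOn S (Metric.ball 0 ρ) ∧
      ∀ l z : ℂ, z ∈ Metric.ball 0 ρ → Complex.exp l * z ∈ Metric.ball 0 ρ →
        A.toFun (l, z) * S z = S (Complex.exp l * z) * A.toFun (l, 0) := by
  have hexp_inv : ∀ (l : ℂ) (Y : Matrix (Fin n) (Fin n) ℂ),
      expGL (-l • Y) * expGL (l • Y) = 1 := by
    intro l Y
    rw [← expGL_add_of_commute (((Commute.refl Y).smul_left _).smul_right _), ← add_smul,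
      neg_add_cancel, zero_smul, expGL_zero]
  obtain ⟨ρ, hρ, hρr, T, hTG, hTd, hT0, hT⟩ :=
    (A.twist hG X hXd hX hinv).exists_trivialization hG fun l => by
      rw [twist_gl, hR, hX0, ← inv_inv (expGL (l • R)), ← eq_inv_of_mul_eq_one_left (hexp_inv l R),
        inv_mul_cancel]
  have hsub : Metric.ball (0 : ℂ) ρ ⊆ A.disc := Metric.ball_subset_ball hρr
  have h0 : (0 : ℂ) ∈ Metric.ball (0 : ℂ) ρ := Metric.mem_ball_self hρ
  simp only [twist_gl] at hT
  have hstep : ∀ l : ℂ, ∀ z ∈ Metric.ball (0 : ℂ) ρ, Complex.exp l * z ∈ Metric.ball 0 ρ →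
      Ad (T (Complex.exp l * z)) (X (Complex.exp l * z)) = Ad (T z) (X z) := by
    intro l z hz hlz
    rw [← hT l z hz hlz, Ad_mul_apply, Ad_mul_apply, Ad_expGL_smul_self,
      hinv l z (hsub hz) (hsub hlz)]
  have hconst : ∀ z ∈ Metric.ball (0 : ℂ) ρ, Ad (T z) (X z) = R := by
    intro z hz
    have hcont : Tendsto (fun z => Ad (T z) (X z)) (𝓝 0) (𝓝 R) := by
      have h2 := ((hTd.Ad_apply (hXd.mono hsub)).differentiableAt
        (Metric.isOpen_ball.mem_nhds h0)).continuousAt.tendsto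
      rwa [hT0, Ad_one_apply, hX0] at h2
    refine tendsto_nhds_unique ?_ (hcont.comp (tendsto_exp_neg_natCast_mul z))
    have hev := (tendsto_exp_neg_natCast_mul z).eventually (Metric.isOpen_ball.mem_nhds h0)
    refine tendsto_const_nhds.congr' ?_
    filter_upwards [hev] with m hm
    exact (hstep _ z hz hm).symm
  have key : ∀ l z : ℂ, z ∈ Metric.ball 0 ρ → Complex.exp l * z ∈ Metric.ball 0 ρ →
      T (Complex.exp l * z) * A.gl l z = A.gl l 0 * T z := by
    intro l z hz hlz
    have h3 : expGL (l • R) = T z * expGL (l • X z) * (T z)⁻¹ := by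
      rw [← expGL_Ad, map_smul, hconst z hz]
    rw [hR, h3, inv_mul_cancel_right, ← hT l z hz hlz]
    simp only [mul_assoc, hexp_inv, mul_one]
  classical
  refine ⟨ρ, hρ, hρr, fun z => if hz : z ∈ Metric.ball (0 : ℂ) ρ then ⟨T z, hTG z hz⟩⁻¹ else 1,
    ?_, fun l z hz hlz => ?_⟩
  · refine isHolomorphicOn_iff.2 (hTd.coe_inv_GL.congr fun z hz => ?_)
    rw [dif_pos hz]
    rfl
  · simp only [dif_pos hz, dif_pos hlz]
    apply Subtype.ext
    have h4 := key l z hz hlz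
    change A.gl l z * (T z)⁻¹ = (T (Complex.exp l * z))⁻¹ * A.gl l 0
    rw [eq_inv_mul_iff_mul_eq, ← mul_assoc, h4, mul_inv_cancel_right]

end LocalCocycle

/-! ### Semisimple monodromy -/

/-- The adjoint action on the Lie algebra of `G`. -/
def AdLie {n : ℕ} {G : Subgroup (GL (Fin n) ℂ)} (hG : IsZariskiClosedSubgroup G)
    (g : GL (Fin n) ℂ) (hg : g ∈ G) : Module.End ℂ (lieSubmodule hG) :=
  (Ad g).restrict fun _ hX => Ad_mem_lieSubmodule hG hg hX

theorem coe_AdLie_apply {n : ℕ} {G : Subgroup (GL (Fin n) ℂ)} (hG : IsZariskiClosedSubgroup G)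
    {g : GL (Fin n) ℂ} (hg : g ∈ G) (X : lieSubmodule hG) : (AdLie hG g hg X : _) = Ad g X := rfl

theorem finrank_lieCentralizer_eq {n : ℕ} {G : Subgroup (GL (Fin n) ℂ)}
    (hG : IsZariskiClosedSubgroup G) {g : GL (Fin n) ℂ} (hg : g ∈ G) :
    Module.finrank ℂ (lieCentralizer hG g) =
      Module.finrank ℂ ((AdLie hG g hg).eigenspace 1) := by
  suffices h : lieCentralizer hG g =
      ((AdLie hG g hg).eigenspace 1).map (lieSubmodule hG).subtype by
    rw [h, Submodule.finrank_map_subtype_eq]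
  ext X
  simp only [mem_lieCentralizer, Submodule.mem_map, Module.End.mem_eigenspace_iff, one_smul]
  constructor
  · rintro ⟨hX, h⟩
    exact ⟨⟨X, hX⟩, Subtype.ext h, rfl⟩
  · rintro ⟨Y, hY, rfl⟩
    exact ⟨Y.2, congrArg Subtype.val hY⟩

/-- For a semisimple `g`, the generalized eigenvectors of `Ad g` for the eigenvalue `1` are
eigenvectors: in an eigenbasis of `g`, `Ad g` is diagonal in the matrix units. -/
theorem IsSemisimpleElt.Ad_eq_of_pow_apply_eq_zero {n : ℕ} {g : GL (Fin n) ℂ}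
    (hg : IsSemisimpleElt g) {X : Matrix (Fin n) (Fin n) ℂ} {k : ℕ}
    (h : ((Ad g - 1) ^ k) X = 0) : Ad g X = X := by
  obtain ⟨Q, hQ⟩ := hg
  set D : GL (Fin n) ℂ := Q⁻¹ * g * Q with hD
  have hgD : g * Q = Q * D := by rw [hD]; group
  have hdiag : Matrix.diagonal (fun i => (D : Matrix (Fin n) (Fin n) ℂ) i i) = D :=
    hQ.diagonal_diag
  have hne : ∀ i, (D : Matrix (Fin n) (Fin n) ℂ) i i ≠ 0 := by
    intro i h0
    have h1 := congrFun (congrFun (Units.mul_inv D) i) i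
    rw [← hdiag, Matrix.diagonal_mul, h0, zero_mul, Matrix.one_apply_eq] at h1
    exact zero_ne_one h1
  have hentry : ∀ (Y : Matrix (Fin n) (Fin n) ℂ) i j, (Ad D Y) i j =
      (D : Matrix (Fin n) (Fin n) ℂ) i i / (D : Matrix (Fin n) (Fin n) ℂ) j j * Y i j := by
    intro Y i j
    have h1 := congrFun (congrFun ((Ad_eq_iff_mul_eq (g := D) (X := Y)).1 rfl) i) j
    rw [← hdiag, Matrix.diagonal_mul, Matrix.mul_diagonal] at h1
    rw [div_mul_eq_mul_div, eq_div_iff (hne j), h1]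
  have hpow : ∀ (k : ℕ) (Y : Matrix (Fin n) (Fin n) ℂ) i j, (((Ad D - 1) ^ k) Y) i j =
      ((D : Matrix (Fin n) (Fin n) ℂ) i i / (D : Matrix (Fin n) (Fin n) ℂ) j j - 1) ^ k
        * Y i j := by
    intro k
    induction k with
    | zero => intro Y i j; simp
    | succ k ih =>
      intro Y i j
      rw [pow_succ, Module.End.mul_apply, ih]
      have h1 : ((Ad D - 1) Y) i j = (Ad D Y) i j - Y i j := rfl
      rw [h1, hentry]
      ring
  have hconj : ∀ (k : ℕ) (Y : Matrix (Fin n) (Fin n) ℂ),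
      ((Ad g - 1) ^ k) (Ad Q Y) = Ad Q (((Ad D - 1) ^ k) Y) := by
    intro k
    induction k with
    | zero => intro Y; simp
    | succ k ih =>
      intro Y
      have h1 : (Ad g - 1) (Ad Q Y) = Ad Q ((Ad D - 1) Y) := by
        rw [LinearMap.sub_apply, LinearMap.sub_apply, map_sub, ← Ad_mul_apply, ← Ad_mul_apply, hgD]
        rfl
      rw [pow_succ, pow_succ, Module.End.mul_apply, Module.End.mul_apply, h1, ih]
  obtain ⟨Y, rfl⟩ : ∃ Y, Ad Q Y = X := ⟨Ad Q⁻¹ X, Ad_apply_inv_apply Q X⟩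
  rw [hconj] at h
  have h2 : ((Ad D - 1) ^ k) Y = 0 := by
    rw [← Ad_inv_apply_apply Q (((Ad D - 1) ^ k) Y), h, map_zero]
  rw [← Ad_mul_apply, hgD, Ad_mul_apply]
  congr 1
  ext i j
  have h3 := congrFun (congrFun h2 i) j
  rw [hpow, Matrix.zero_apply] at h3
  rw [hentry]
  rcases mul_eq_zero.1 h3 with h4 | h4
  · rw [sub_eq_zero.1 (eq_zero_of_pow_eq_zero h4), one_mul]
  · rw [h4, mul_zero]

theorem finrank_lieCentralizer_eq_rootMultiplicity {n : ℕ} {G : Subgroup (GL (Fin n) ℂ)}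
    (hG : IsZariskiClosedSubgroup G) {g : GL (Fin n) ℂ} (hg : g ∈ G) (hs : IsSemisimpleElt g) :
    Module.finrank ℂ (lieCentralizer hG g) = (AdLie hG g hg).charpoly.rootMultiplicity 1 := by
  suffices h : (AdLie hG g hg).eigenspace 1 = (AdLie hG g hg).maxGenEigenspace 1 by
    rw [finrank_lieCentralizer_eq hG hg, h, LinearMap.finrank_maxGenEigenspace_eq]
  refine le_antisymm ((AdLie hG g hg).genEigenspace_le_maximal 1 1) fun X hX => ?_
  obtain ⟨k, hk⟩ := Module.End.mem_maxGenEigenspace _ _ _ |>.1 hX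
  rw [one_smul] at hk
  have hpow : ∀ (k : ℕ) (Y : lieSubmodule hG),
      ((((AdLie hG g hg - 1) ^ k) Y : lieSubmodule hG) : Matrix (Fin n) (Fin n) ℂ) =
        ((Ad g - 1) ^ k) (Y : Matrix (Fin n) (Fin n) ℂ) := by
    intro k
    induction k with
    | zero => intro Y; simp
    | succ k ih =>
      intro Y
      rw [pow_succ, pow_succ, Module.End.mul_apply, Module.End.mul_apply, ih]
      rfl
  rw [Module.End.mem_eigenspace_iff, one_smul]
  refine Subtype.ext (hs.Ad_eq_of_pow_apply_eq_zero (k := k) ?_)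
  exact (hpow k X).symm.trans (congrArg Subtype.val hk)

theorem finrank_lieCentralizer_le_rootMultiplicity {n : ℕ} {G : Subgroup (GL (Fin n) ℂ)}
    (hG : IsZariskiClosedSubgroup G) {g : GL (Fin n) ℂ} (hg : g ∈ G) :
    Module.finrank ℂ (lieCentralizer hG g) ≤ (AdLie hG g hg).charpoly.rootMultiplicity 1 := by
  rw [finrank_lieCentralizer_eq hG hg, ← LinearMap.finrank_maxGenEigenspace_eq]
  exact Submodule.finrank_mono ((AdLie hG g hg).genEigenspace_le_maximal 1 1)

theorem charpoly_AdLie_conj {n : ℕ} {G : Subgroup (GL (Fin n) ℂ)}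
    (hG : IsZariskiClosedSubgroup G) {g h c : GL (Fin n) ℂ} (hg : g ∈ G) (hh : h ∈ G) (hc : c ∈ G)
    (heq : g * c = c * h) : (AdLie hG g hg).charpoly = (AdLie hG h hh).charpoly := by
  let e : lieSubmodule hG ≃ₗ[ℂ] lieSubmodule hG := LinearEquiv.ofLinearMap (AdLie hG c hc)
    (AdLie hG c⁻¹ (G.inv_mem hc))
    (by ext1 X; exact Subtype.ext (Ad_apply_inv_apply c _))
    (by ext1 X; exact Subtype.ext (Ad_inv_apply_apply c _))
  rw [← LinearEquiv.charpoly_conj e (AdLie hG h hh)]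
  congr 1
  ext1 X
  refine Subtype.ext ?_
  change Ad g X = Ad c (Ad h (Ad c⁻¹ X))
  rw [← Ad_mul_apply, ← Ad_mul_apply, ← heq, mul_inv_cancel_right]

namespace LocalCocycle

variable {n : ℕ} {G : Subgroup (GL (Fin n) ℂ)} (A : LocalCocycle G)

theorem mul_two_pi_mem_disc {z : ℂ} (hz : z ∈ A.disc) :
    Complex.exp (2 * Real.pi * Complex.I) * z ∈ A.disc := by
  rwa [Complex.exp_two_pi_mul_I, one_mul]

/-- The characteristic polynomial of the adjoint action of the monodromy is constant along the
punctured disc, hence, by continuity, on the disc. -/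
theorem charpoly_AdLie_monodromy_zero (hG : IsZariskiClosedSubgroup G) :
    (AdLie hG (A.gl (2 * Real.pi * Complex.I) 0) (A.gl_mem _ _)).charpoly =
      (AdLie hG A.baseMonodromy (A.gl_mem _ _)).charpoly := by
  have hconst : ∀ z ∈ A.disc, z ≠ 0 →
      (AdLie hG (A.gl (2 * Real.pi * Complex.I) z) (A.gl_mem _ _)).charpoly =
        (AdLie hG A.baseMonodromy (A.gl_mem _ _)).charpoly := by
    intro z hz hz0
    have h0 := A.basePoint_ne_zero
    set l := Complex.log (z / A.basePoint)
    have hl : Complex.exp l * A.basePoint = z := by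
      rw [Complex.exp_log (div_ne_zero hz0 h0), div_mul_cancel₀ _ h0]
    have hlz : Complex.exp (2 * Real.pi * Complex.I + l) * A.basePoint ∈ A.disc := by
      rwa [Complex.exp_add, Complex.exp_two_pi_mul_I, one_mul, hl]
    have h1 := A.gl_add (l := 2 * Real.pi * Complex.I) (m := l) A.basePoint_mem
      (hl.symm ▸ hz) hlz
    have h2 := A.gl_add (l := l) (m := 2 * Real.pi * Complex.I) A.basePoint_mem
      (A.mul_two_pi_mem_disc A.basePoint_mem) (by rwa [add_comm])
    rw [Complex.exp_two_pi_mul_I, one_mul, add_comm, h1, hl] at h2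
    exact charpoly_AdLie_conj hG _ _ (A.gl_mem _ _) h2
  let b := Module.finBasis ℂ (lieSubmodule hG)
  choose φ hφ using fun i => (b.coord i).exists_extend
  have hcont : ContinuousAt (fun z => LinearMap.toMatrix b b
      (AdLie hG (A.gl (2 * Real.pi * Complex.I) z) (A.gl_mem _ _))) 0 := by
    refine continuousAt_pi.2 fun i => continuousAt_pi.2 fun j => ?_
    have h1 : ∀ z, LinearMap.toMatrix b b
        (AdLie hG (A.gl (2 * Real.pi * Complex.I) z) (A.gl_mem _ _)) i j =
          φ i (Ad (A.gl (2 * Real.pi * Complex.I) z) (b j)) := by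
      intro z
      rw [LinearMap.toMatrix_apply, ← coe_AdLie_apply hG (A.gl_mem _ _)]
      exact (LinearMap.congr_fun (hφ i) _).symm
    simp only [h1]
    refine (LinearMap.continuous_of_finiteDimensional (φ i)).continuousAt.comp ?_
    exact ((A.continuousAt_gl_zero _).mul continuousAt_const).mul (A.continuousAt_gl_inv_zero _)
  refine Polynomial.funext fun t => ?_
  have hcont' : ContinuousAt (fun z =>
      (AdLie hG (A.gl (2 * Real.pi * Complex.I) z) (A.gl_mem _ _)).charpoly.eval t) 0 := by
    simp only [← LinearMap.charpoly_toMatrix _ b, Matrix.eval_charpoly]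
    exact (Continuous.matrix_det continuous_id).continuousAt.comp (continuousAt_const.sub hcont)
  refine tendsto_nhds_unique (hcont'.tendsto.mono_left (nhdsWithin_le_nhds (s := {0}ᶜ)))
    (tendsto_const_nhds.congr' ?_)
  filter_upwards [nhdsWithin_le_nhds (Metric.isOpen_ball.mem_nhds A.zero_mem_disc),
    self_mem_nhdsWithin] with z hz hz0
  rw [hconst z hz hz0]

theorem finrank_lieCentralizer_le_of_isSemisimpleElt (hG : IsZariskiClosedSubgroup G)
    (hs : IsSemisimpleElt A.baseMonodromy) :
    Module.finrank ℂ (lieCentralizer hG (A.gl (2 * Real.pi * Complex.I) 0)) ≤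
      Module.finrank ℂ (lieCentralizer hG A.baseMonodromy) := by
  rw [finrank_lieCentralizer_eq_rootMultiplicity hG (g := A.baseMonodromy) (A.gl_mem _ _) hs,
    ← A.charpoly_AdLie_monodromy_zero hG]
  exact finrank_lieCentralizer_le_rootMultiplicity hG _

end LocalCocycle

/-! ### Representations in local trivializations -/

namespace HolomorphicPrincipalBundle

variable {n : ℕ} {G : Subgroup (GL (Fin n) ℂ)} {P : HolomorphicPrincipalBundle.{u} G}

/-- A point of the total space, as a point of its fibre. -/
def toFiber (P : HolomorphicPrincipalBundle.{u} G) (p : P.Total) : P.Fiber (P.proj p) := ⟨p, rfl⟩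

theorem smul_right_cancel {p : P.Total} {g h : G} (hgh : p <• g = p <• h) : g = h :=
  (P.existsUnique_smul p (p <• h) (P.proj_smul p h).symm).unique hgh rfl

theorem smul_op_mul (p : P.Total) (g h : G) : p <• (g * h) = p <• g <• h := by
  rw [MulOpposite.op_mul, mul_smul]

theorem coe_smul_diff {z : ℂ} (p q : P.Fiber z) : p.1 <• diff p q = q.1 :=
  congrArg Subtype.val (smul_diff p q)

theorem diff_eq_iff {z : ℂ} {p q : P.Fiber z} {g : G} : diff p q = g ↔ p.1 <• g = q.1 := by
  constructor
  · rintro rfl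
    exact coe_smul_diff p q
  · intro h
    exact (eq_diff (Subtype.ext h)).symm

end HolomorphicPrincipalBundle

theorem IsHolomorphicOn.inv {n : ℕ} {G : Subgroup (GL (Fin n) ℂ)} {E : Type*}
    [NormedAddCommGroup E] [NormedSpace ℂ E] {g : E → G} {s : Set E} (h : IsHolomorphicOn g s) :
    IsHolomorphicOn (fun x => (g x)⁻¹) s :=
  isHolomorphicOn_iff.2 (isHolomorphicOn_iff.1 h).coe_inv_GL

theorem IsHolomorphicOn.mul {n : ℕ} {G : Subgroup (GL (Fin n) ℂ)} {E : Type*}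
    [NormedAddCommGroup E] [NormedSpace ℂ E] {g h : E → G} {s : Set E} (hg : IsHolomorphicOn g s)
    (hh : IsHolomorphicOn h s) : IsHolomorphicOn (fun x => g x * h x) s :=
  isHolomorphicOn_iff.2 ((isHolomorphicOn_iff.1 hg).mul (isHolomorphicOn_iff.1 hh))

theorem IsHolomorphicOn.comp {n : ℕ} {G : Subgroup (GL (Fin n) ℂ)} {E F : Type*}
    [NormedAddCommGroup E] [NormedSpace ℂ E] [NormedAddCommGroup F] [NormedSpace ℂ F] {g : E → G}
    {s : Set E} (hg : IsHolomorphicOn g s) {f : F → E} {t : Set F} (hf : DifferentiableOn ℂ f t)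
    (h : Set.MapsTo f t s) : IsHolomorphicOn (fun x => g (f x)) t := fun a b =>
  (hg a b).comp hf h

theorem IsHolomorphicOn.of_locally {n : ℕ} {G : Subgroup (GL (Fin n) ℂ)} {E : Type*}
    [NormedAddCommGroup E] [NormedSpace ℂ E] {g : E → G} {s : Set E}
    (h : ∀ x ∈ s, ∃ t, IsOpen t ∧ x ∈ t ∧ ∃ g' : E → G, IsHolomorphicOn g' t ∧
      ∀ y ∈ t, g y = g' y) : IsHolomorphicOn g s := by
  intro a b x hx
  obtain ⟨t, ht, hxt, g', hg', heq⟩ := h x hx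
  refine DifferentiableAt.differentiableWithinAt ?_
  refine ((hg' a b).differentiableAt (ht.mem_nhds hxt)).congr_of_eventuallyEq ?_
  filter_upwards [ht.mem_nhds hxt] with y hy
  rw [heq y hy]

namespace GroupoidRep

variable {n : ℕ} {G : Subgroup (GL (Fin n) ℂ)} {P : HolomorphicPrincipalBundle.{u} G}
  (Φ : GroupoidRep P)

/-- The action of `ℂ` on the total space of `P` which a representation of `ℂ ⋉ 𝔸` amounts to. -/
noncomputable def act (l : ℂ) (p : P.Total) : P.Total := (Φ.toFun l (P.proj p) (P.toFiber p)).1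

theorem coe_toFun (l z : ℂ) (p : P.Fiber z) : (Φ.toFun l z p).1 = Φ.act l p.1 :=
  Φ.toFun_congr l rfl

theorem proj_act (l : ℂ) (p : P.Total) : P.proj (Φ.act l p) = Complex.exp l * P.proj p :=
  (Φ.toFun l (P.proj p) (P.toFiber p)).2

theorem act_add (l m : ℂ) (p : P.Total) : Φ.act (l + m) p = Φ.act l (Φ.act m p) := by
  rw [act, Φ.map_add, coe_toFun, coe_toFun]
  rfl

theorem act_smul (l : ℂ) (p : P.Total) (g : G) : Φ.act l (p <• g) = Φ.act l p <• g := by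
  have h := congrArg Subtype.val (map_smul (Φ.toFun l (P.proj p)) (MulOpposite.op g) (P.toFiber p))
  rw [coe_toFun, Fiber.coe_smul] at h
  exact h

theorem coe_restrictZero (l : ℂ) (p : P.Fiber 0) : (Φ.restrictZero l p).1 = Φ.act l p.1 :=
  Φ.coe_toFun l 0 p

theorem coe_monodromy (z : ℂ) (p : P.Fiber z) :
    (Φ.monodromy z p).1 = Φ.act (2 * Real.pi * Complex.I) p.1 :=
  Φ.coe_toFun _ z p

theorem exists_act_sec (i j : P.Idx) : ∃ g : ℂ × ℂ → G,
    IsHolomorphicOn g {x | x.2 ∈ P.dom i ∧ Complex.exp x.1 * x.2 ∈ P.dom j} ∧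
    ∀ l z : ℂ, z ∈ P.dom i → Complex.exp l * z ∈ P.dom j →
      Φ.act l (P.sec i z) = P.sec j (Complex.exp l * z) <• g (l, z) := by
  obtain ⟨g, hg, h⟩ := Φ.holomorphic i j
  refine ⟨g, hg, fun l z hi hj => ?_⟩
  have h1 := congrArg Subtype.val (h l z hi hj)
  rwa [coe_toFun] at h1

/-- The local cocycle that describes a representation in a trivialization around `0`. -/
noncomputable def localCocycle {i : P.Idx} {r : ℝ} (hr : 0 < r)
    (hi : Metric.ball 0 r ⊆ P.dom i) : LocalCocycle G where
  radius := r
  radius_pos := hr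
  toFun := (Φ.exists_act_sec i i).choose
  holomorphic a b := ((Φ.exists_act_sec i i).choose_spec.1 a b).mono
    fun _ hx => ⟨hi hx.1, hi hx.2⟩
  map_add l m z h1 h2 h3 := by
    have hspec := (Φ.exists_act_sec i i).choose_spec.2
    have h3' : Complex.exp l * (Complex.exp m * z) ∈ P.dom i := by
      rw [← mul_assoc, ← Complex.exp_add]
      exact hi h3
    apply smul_right_cancel (p := P.sec i (Complex.exp (l + m) * z))
    rw [← hspec (l + m) z (hi h1) (hi h3), act_add, hspec m z (hi h1) (hi h2), act_smul,
      hspec l _ (hi h2) h3', smul_op_mul, Complex.exp_add, mul_assoc]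

theorem act_sec {i : P.Idx} {r : ℝ} (hr : 0 < r) (hi : Metric.ball 0 r ⊆ P.dom i) {l z : ℂ}
    (hz : z ∈ Metric.ball 0 r) (hl : Complex.exp l * z ∈ Metric.ball 0 r) :
    Φ.act l (P.sec i z) =
      P.sec i (Complex.exp l * z) <• (Φ.localCocycle hr hi).toFun (l, z) :=
  (Φ.exists_act_sec i i).choose_spec.2 l z (hi hz) (hi hl)

theorem act_sec_zero {i : P.Idx} {r : ℝ} (hr : 0 < r) (hi : Metric.ball 0 r ⊆ P.dom i) (l : ℂ) :
    Φ.act l (P.sec i 0) = P.sec i 0 <• (Φ.localCocycle hr hi).toFun (l, 0) := by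
  have h := Φ.act_sec hr hi (l := l) (Metric.mem_ball_self hr) (by simpa using hr)
  rwa [mul_zero] at h

theorem localCocycle_gl_zero {i : P.Idx} {r : ℝ} (hr : 0 < r) (hi : Metric.ball 0 r ⊆ P.dom i)
    (l : ℂ) : (Φ.localCocycle hr hi).gl l 0 =
      expGL (l • Φ.residueFun (P.secFiber i 0 (hi (Metric.mem_ball_self hr)))) := by
  rw [expGL_residueFun]
  refine congrArg Subtype.val (diff_eq_iff.2 ?_).symm
  rw [coe_restrictZero]
  exact (Φ.act_sec_zero hr hi l).symm

/-- If the monodromy at `1` is conjugate to the monodromy at `0`, so are the corresponding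
elements of `G` in a trivialization around `0`. -/
theorem exists_baseMonodromy_mul_eq {i : P.Idx} {r : ℝ} (hr : 0 < r)
    (hi : Metric.ball 0 r ⊆ P.dom i)
    (hconj : AreConjugate (Φ.monodromy 1) ((2 * Real.pi * Complex.I : ℂ) • Φ.residue).exp) :
    ∃ c ∈ G, (Φ.localCocycle hr hi).baseMonodromy * c =
      c * (Φ.localCocycle hr hi).gl (2 * Real.pi * Complex.I) 0 := by
  obtain ⟨C, hC⟩ := hconj
  set A := Φ.localCocycle hr hi
  have hb := A.basePoint_mem
  set b := A.basePoint
  set p := P.secFiber i 0 (hi (Metric.mem_ball_self hr))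
  have hlog : Complex.exp (Complex.log b) = b := Complex.exp_log A.basePoint_ne_zero
  let q : P.Fiber b := ⟨Φ.act (Complex.log b) (C p).1, by
    rw [proj_act, (C p).2, mul_one, hlog]⟩
  let s : P.Fiber b := P.secFiber i b (hi hb)
  refine ⟨diff s q, (diff s q).2, ?_⟩
  have h1 : Φ.act (2 * Real.pi * Complex.I) q.1 = q.1 <• A.toFun (2 * Real.pi * Complex.I, 0) := by
    have h2 := hC p
    rw [← restrictZero_eq_exp] at h2
    have h3 : Φ.restrictZero (2 * Real.pi * Complex.I) p
        = p <• A.toFun (2 * Real.pi * Complex.I, 0) := by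
      apply Subtype.ext
      rw [coe_restrictZero]
      exact Φ.act_sec_zero hr hi _
    rw [h3, map_smul] at h2
    have h4 := congrArg Subtype.val h2
    rw [coe_monodromy, Fiber.coe_smul] at h4
    rw [← act_add, add_comm, act_add, h4, act_smul]
  have h5 : Φ.act (2 * Real.pi * Complex.I) s.1
      = s.1 <• A.toFun (2 * Real.pi * Complex.I, b) := by
    have h6 := Φ.act_sec hr hi (l := 2 * Real.pi * Complex.I) hb (A.mul_two_pi_mem_disc hb)
    rwa [Complex.exp_two_pi_mul_I, one_mul] at h6
  have h7 : A.toFun (2 * Real.pi * Complex.I, b) * diff s q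
      = diff s q * A.toFun (2 * Real.pi * Complex.I, 0) := by
    apply smul_right_cancel (p := s.1)
    rw [smul_op_mul, smul_op_mul, ← h5, ← act_smul, coe_smul_diff, h1]
  exact congrArg Subtype.val h7

theorem isSemisimpleElt_baseMonodromy {i : P.Idx} {r : ℝ} (hr : 0 < r)
    (hi : Metric.ball 0 r ⊆ P.dom i) (hs : IsSemisimpleAut (Φ.monodromy 1)) :
    IsSemisimpleElt (Φ.localCocycle hr hi).baseMonodromy := by
  set A := Φ.localCocycle hr hi
  have hb := A.basePoint_mem
  have hb0 := A.basePoint_ne_zero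
  set b := A.basePoint with hbdef
  let q : P.Fiber 1 := ⟨Φ.act (-Complex.log b) (P.sec i b), by
    rw [proj_act, P.proj_sec i b (hi hb), Complex.exp_neg, Complex.exp_log hb0,
      inv_mul_cancel₀ hb0]⟩
  have h1 : diff q (Φ.monodromy 1 q) = A.toFun (2 * Real.pi * Complex.I, b) := by
    rw [diff_eq_iff, coe_monodromy]
    have h2 := Φ.act_sec hr hi (l := 2 * Real.pi * Complex.I) hb (A.mul_two_pi_mem_disc hb)
    rw [Complex.exp_two_pi_mul_I, one_mul] at h2
    change Φ.act _ (P.sec i b) <• _ = Φ.act _ (Φ.act _ _)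
    rw [← act_add, add_comm, act_add, h2, act_smul]
  have h3 := hs q
  rw [h1] at h3
  exact h3

end GroupoidRep

/-! ### Morphisms of representations -/

namespace GroupoidRep

variable {n : ℕ} {G : Subgroup (GL (Fin n) ℂ)}

theorem Hom.bijective {P Q : HolomorphicPrincipalBundle.{u} G} {Φ : GroupoidRep P}
    {Ψ : GroupoidRep Q} (T : Hom Φ Ψ) (z : ℂ) : Function.Bijective (T.toFun z) := by
  constructor
  · intro p q h
    have h1 : T.toFun z p <• diff p q = T.toFun z p <• (1 : G) := by
      rw [← map_smul, smul_diff, MulOpposite.op_one, one_smul, h]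
    have h2 : diff p q = 1 := smul_right_cancel (congrArg Subtype.val h1)
    rw [← smul_diff p q, h2, MulOpposite.op_one, one_smul]
  · intro q
    obtain ⟨i, hi⟩ := P.cover z
    refine ⟨P.secFiber i z hi <• diff (T.toFun z (P.secFiber i z hi)) q, ?_⟩
    rw [map_smul, smul_diff]

/-- A morphism of principal bundles is an isomorphism, and so is a morphism of representations. -/
theorem Hom.isIsomorphic {P Q : HolomorphicPrincipalBundle.{u} G} {Φ : GroupoidRep P}
    {Ψ : GroupoidRep Q} (T : Hom Φ Ψ) : IsIsomorphic Φ Ψ := by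
  let e : ∀ z, P.Fiber z ≃ Q.Fiber z := fun z => Equiv.ofBijective _ (T.bijective z)
  have he : ∀ z p, e z p = T.toFun z p := fun z p => rfl
  have hsmul : ∀ z (g : Gᵐᵒᵖ) q, (e z).symm (g • q) = g • (e z).symm q := by
    intro z g q
    rw [Equiv.symm_apply_eq, he, map_smul, ← he, Equiv.apply_symm_apply]
  refine ⟨T, { toFun := fun z => ⟨(e z).symm, hsmul z⟩, holomorphic := ?_, comm := ?_ },
    fun z p => (e z).symm_apply_apply p, fun z q => (e z).apply_symm_apply q⟩
  · intro j i
    obtain ⟨g, hg, h⟩ := T.holomorphic i j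
    refine ⟨fun z => (g z)⁻¹, by rw [Set.inter_comm]; exact hg.inv, fun z hj hi => ?_⟩
    change (e z).symm _ = _
    rw [Equiv.symm_apply_eq, he, map_smul, h z hi hj, smul_smul, ← MulOpposite.op_mul,
      mul_inv_cancel, MulOpposite.op_one, one_smul]
  · intro l z q
    change (e _).symm _ = Φ.toFun l z ((e z).symm q)
    rw [Equiv.symm_apply_eq, he, T.comm, ← he, Equiv.apply_symm_apply]

theorem Hom.coe_toFun_congr {P Q : HolomorphicPrincipalBundle.{u} G} {Φ : GroupoidRep P}
    {Ψ : GroupoidRep Q} (T : Hom Φ Ψ) {z w : ℂ} {p : P.Fiber z} {q : P.Fiber w} (h : p.1 = q.1) :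
    (T.toFun z p).1 = (T.toFun w q).1 := by
  obtain ⟨p, rfl⟩ := p
  obtain ⟨q, rfl⟩ := q
  obtain rfl : p = q := h
  rfl

variable {P : HolomorphicPrincipalBundle.{u} G} (Φ : GroupoidRep P)

/-- The fibre over `1` of a morphism from the linear approximation conjugates the monodromies. -/
theorem areConjugate_of_hom (T : Hom Φ.linearApprox Φ) :
    AreConjugate (Φ.monodromy 1) ((2 * Real.pi * Complex.I : ℂ) • Φ.residue).exp := by
  let ι : P.Fiber 0 → P.linearize.Fiber 1 := fun p => ⟨(p, 1), rfl⟩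
  refine ⟨⟨fun p => T.toFun 1 (ι p), fun g p => map_smul (T.toFun 1) g (ι p)⟩, fun p => ?_⟩
  apply Subtype.ext
  have h := congrArg Subtype.val (T.comm (2 * Real.pi * Complex.I) 1 (ι p))
  rw [coe_toFun] at h
  rw [coe_monodromy]
  refine h.symm.trans (T.coe_toFun_congr (Prod.ext rfl ?_))
  change Complex.exp _ * 1 = 1
  rw [Complex.exp_two_pi_mul_I, one_mul]

/-- A linearization over a disc around `0` extends to `𝔸`, because every point of `𝔸` can be moved
into the disc by the action of `ℂ`. -/
theorem nonempty_hom_of_local_linearization {i : P.Idx} {r : ℝ} (hr : 0 < r)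
    (hi : Metric.ball 0 r ⊆ P.dom i) {ρ : ℝ} (hρ : 0 < ρ) (hρr : ρ ≤ r) {S : ℂ → G}
    (hS : IsHolomorphicOn S (Metric.ball 0 ρ))
    (heq : ∀ l z : ℂ, z ∈ Metric.ball 0 ρ → Complex.exp l * z ∈ Metric.ball 0 ρ →
      (Φ.localCocycle hr hi).toFun (l, z) * S z =
        S (Complex.exp l * z) * (Φ.localCocycle hr hi).toFun (l, 0)) :
    Nonempty (Hom Φ.linearApprox Φ) := by
  set A := Φ.localCocycle hr hi
  set p₀ := P.secFiber i 0 (hi (Metric.mem_ball_self hr))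
  have hsub : Metric.ball (0 : ℂ) ρ ⊆ Metric.ball 0 r := Metric.ball_subset_ball hρr
  have hA0 : ∀ l m, A.toFun (l + m, 0) = A.toFun (l, 0) * A.toFun (m, 0) := fun l m =>
    Subtype.ext (A.gl_add_zero l m)
  have hexp : ∀ l z : ℂ, Complex.exp l * (Complex.exp (-l) * z) = z := fun l z => by
    rw [← mul_assoc, ← Complex.exp_add, add_neg_cancel, Complex.exp_zero, one_mul]
  -- The local linearization at `exp (-l) * z`, transported to `z`.
  let E : ℂ → ℂ → P.Fiber 0 → P.Total := fun l z p => Φ.act l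
    (P.sec i (Complex.exp (-l) * z) <• (S (Complex.exp (-l) * z) * A.toFun (-l, 0) * diff p₀ p))
  have hE : ∀ l z p, E l z p = Φ.act l (P.sec i (Complex.exp (-l) * z)) <•
      (S (Complex.exp (-l) * z) * A.toFun (-l, 0) * diff p₀ p) := fun l z p => Φ.act_smul _ _ _
  have hproj : ∀ l z p, Complex.exp (-l) * z ∈ Metric.ball 0 ρ → P.proj (E l z p) = z := by
    intro l z p hl
    rw [proj_act, P.proj_smul, P.proj_sec i _ (hi (hsub hl)), hexp]
  have hsmul : ∀ l z p (g : G), E l z (p <• g) = E l z p <• g := by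
    intro l z p g
    have h1 : diff p₀ (p <• g) = diff p₀ p * g := by
      rw [diff_eq_iff, smul_op_mul, coe_smul_diff, Fiber.coe_smul]
    rw [hE, hE, h1, ← mul_assoc, smul_op_mul]
  have hindep : ∀ l m z p, Complex.exp (-l) * z ∈ Metric.ball 0 ρ →
      Complex.exp (-m) * z ∈ Metric.ball 0 ρ → E l z p = E m z p := by
    intro l m z p hl hm
    have h1 : Complex.exp (l - m) * (Complex.exp (-l) * z) = Complex.exp (-m) * z := by
      rw [← mul_assoc, ← Complex.exp_add]
      congr 2
      ring
    have hm' : Complex.exp (l - m) * (Complex.exp (-l) * z) ∈ Metric.ball 0 ρ := by rwa [h1]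
    have h2 : A.toFun (-m, 0) = A.toFun (l - m, 0) * A.toFun (-l, 0) := by
      rw [← hA0]
      congr 2
      ring
    have h3 : Φ.act l (P.sec i (Complex.exp (-l) * z)) =
        Φ.act m (P.sec i (Complex.exp (-m) * z)) <•
          A.toFun (l - m, Complex.exp (-l) * z) := by
      rw [← act_smul, ← h1, ← Φ.act_sec hr hi (hsub hl) (hsub hm'), ← act_add, add_sub_cancel]
    rw [hE, hE, h3, ← smul_op_mul, ← mul_assoc, ← mul_assoc, heq _ _ hl hm', h1, h2]
    simp only [mul_assoc]
  have hact : ∀ l m z p, Φ.act m (E l z p) =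
      E (m + l) (Complex.exp m * z) (Φ.restrictZero m p) := by
    intro l m z p
    have h1 : Complex.exp (-(m + l)) * (Complex.exp m * z) = Complex.exp (-l) * z := by
      rw [← mul_assoc, ← Complex.exp_add]
      congr 2
      ring
    have h2 : diff p₀ (Φ.restrictZero m p) = A.toFun (m, 0) * diff p₀ p := by
      rw [diff_eq_iff, coe_restrictZero, ← coe_smul_diff p₀ p, act_smul, smul_op_mul]
      congr 1
      exact (Φ.act_sec_zero hr hi m).symm
    have h3 : A.toFun (-l, 0) = A.toFun (-(m + l), 0) * A.toFun (m, 0) := by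
      rw [← hA0]
      congr 2
      ring
    rw [hE, hE, h1, h2, act_smul, ← act_add, h3]
    simp only [mul_assoc]
  have hN : ∀ z : ℂ, ∃ N : ℕ, Complex.exp (-N) * z ∈ Metric.ball 0 ρ := fun z =>
    ((tendsto_exp_neg_natCast_mul z).eventually (Metric.ball_mem_nhds 0 hρ)).exists
  choose N hN using hN
  let T : ∀ z, P.Fiber 0 → P.Fiber z := fun z p => ⟨E (N z) z p, hproj _ _ _ (hN z)⟩
  classical
  refine ⟨{ toFun := fun z => ⟨fun p => T z p.1.1, fun g p => ?_⟩, holomorphic := ?_, comm := ?_ }⟩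
  · exact Subtype.ext (hsmul _ z p.1.1 g.unop)
  · intro (p : P.Fiber 0) j
    refine ⟨fun z => if hz : z ∈ P.dom j then diff (P.secFiber j z hz) (T z p) else 1,
      IsHolomorphicOn.of_locally fun w hw => ?_, fun z _ hj => ?_⟩
    · obtain ⟨g, hg, hgs⟩ := Φ.exists_act_sec i j
      have hcont : Continuous fun z : ℂ => Complex.exp (-(N w)) * z := by fun_prop
      refine ⟨P.dom j ∩ (fun z : ℂ => Complex.exp (-(N w)) * z) ⁻¹' Metric.ball 0 ρ,
        (P.isOpen_dom j).inter (Metric.isOpen_ball.preimage hcont), ⟨hw.2, hN w⟩,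
        fun z => g ((N w : ℂ), Complex.exp (-(N w)) * z) *
          (S (Complex.exp (-(N w)) * z) * (A.toFun (-(N w), 0) * diff p₀ p)), ?_, ?_⟩
      · have hd : Differentiable ℂ fun z : ℂ => Complex.exp (-(N w)) * z := by fun_prop
        refine IsHolomorphicOn.mul ?_ (IsHolomorphicOn.mul ?_ ?_)
        · refine hg.comp (f := fun z : ℂ => ((N w : ℂ), Complex.exp (-(N w)) * z))
            ((differentiable_const _).prodMk hd).differentiableOn fun z hz => ?_
          refine ⟨hi (hsub hz.2), ?_⟩
          rw [hexp]
          exact hz.1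
        · exact hS.comp hd.differentiableOn fun z hz => hz.2
        · exact fun _ _ => differentiableOn_const _
      · rintro z ⟨hz, hz'⟩
        have h1 := hgs (N w) (Complex.exp (-(N w)) * z) (hi (hsub hz')) (by rwa [hexp])
        rw [hexp] at h1
        rw [dif_pos hz, diff_eq_iff]
        change P.sec j z <• _ = E (N z) z p
        rw [hindep _ (N w) z p (hN z) hz', hE, h1, ← smul_op_mul, mul_assoc (S _)]
    · simp only [dif_pos hj]
      exact (smul_diff _ _).symm
  · intro l z p
    obtain ⟨⟨p, w⟩, rfl : w = z⟩ := p
    apply Subtype.ext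
    rw [coe_toFun]
    change E (N (Complex.exp l * w)) (Complex.exp l * w) ((l • Φ.residue).exp p) =
      Φ.act l (E (N w) w p)
    rw [hact, ← restrictZero_eq_exp]
    refine hindep _ _ _ _ (hN _) ?_
    have h1 : Complex.exp (-(l + N w)) * (Complex.exp l * w) = Complex.exp (-(N w)) * w := by
      rw [← mul_assoc, ← Complex.exp_add]
      congr 2
      ring
    rw [h1]
    exact hN w

/-- The criterion behind both parts of the linearization theorem: `Φ` is linearizable as soon as
the centralizer of its monodromy around `0` is at least as large as that of its monodromy at
`0`. -/
theorem isLinearizable_of_finrank_le (hG : IsZariskiClosedSubgroup G) {i : P.Idx} {r : ℝ}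
    (hr : 0 < r) (hi : Metric.ball 0 r ⊆ P.dom i)
    (hdim : Module.finrank ℂ
        (lieCentralizer hG ((Φ.localCocycle hr hi).gl (2 * Real.pi * Complex.I) 0)) ≤
      Module.finrank ℂ (lieCentralizer hG (Φ.localCocycle hr hi).baseMonodromy)) :
    Φ.IsLinearizable := by
  set A := Φ.localCocycle hr hi
  set p₀ := P.secFiber i 0 (hi (Metric.mem_ball_self hr))
  have hgl := Φ.localCocycle_gl_zero hr hi
  have hR : Φ.residueFun p₀ ∈ lieSubmodule hG := Φ.residue.mem_lieAlg p₀
  obtain ⟨X, hXd, hX0, hX, hinv⟩ := LocalCocycle.exists_invariant_section hG hdim hR fun l => by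
    rw [hgl, Ad_expGL_smul_self]
  obtain ⟨ρ, hρ, hρr, S, hS, heq⟩ :=
    A.exists_linearization_of_invariant_section hG hgl X hXd hX0 hX hinv
  obtain ⟨T⟩ := Φ.nonempty_hom_of_local_linearization hr hi hρ hρr hS heq
  exact T.isIsomorphic

end GroupoidRep

theorem mainTheorem4 {n : ℕ} (G : Subgroup (GL (Fin n) ℂ)) (hG : IsConnectedReductive G)
    (P : HolomorphicPrincipalBundle.{u} G) (Φ : GroupoidRep P) :
    (Φ.IsLinearizable ↔
      AreConjugate (Φ.monodromy 1)
        ((2 * Real.pi * Complex.I : ℂ) • Φ.residue).exp) ∧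
    (IsSemisimpleAut (Φ.monodromy 1) → Φ.IsLinearizable) := by
  have hGc := hG.zariskiClosed
  obtain ⟨i, h0⟩ := P.cover 0
  obtain ⟨r, hr, hi⟩ := Metric.isOpen_iff.1 (P.isOpen_dom i) 0 h0
  refine ⟨⟨fun ⟨T, _⟩ => Φ.areConjugate_of_hom T, fun hconj => ?_⟩, fun hs => ?_⟩
  · obtain ⟨c, hc, h⟩ := Φ.exists_baseMonodromy_mul_eq hr hi hconj
    exact Φ.isLinearizable_of_finrank_le hGc hr hi (finrank_lieCentralizer_conj hGc hc h)
  · exact Φ.isLinearizable_of_finrank_le hGc hr hi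
      ((Φ.localCocycle hr hi).finrank_lieCentralizer_le_of_isSemisimpleElt hGc
        (Φ.isSemisimpleElt_baseMonodromy hr hi hs))
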